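/- **Theorem.** For $B>0$ let $$H_B=\Bigl(-i\frac{\partial}{\partial x_1}+\frac{Bx_2}{2}\Bigr)^2+\Bigl(-i\frac{\partial}{\partial x_2}-\frac{Bx_1}{2}\Bigr)^2$$ be the Landau Hamiltonian in $L^2(\mathbb R^2)$, and for $\omega_1,\omega_2,\mu>0$ let $V(x)=\omega_1^2x_1^2+\omega_2^2x_2^2-\mu$. Let $H_B+V$ denote the closure in $L^2(\mathbb R^2)$ of the corresponding differential operator on Schwartz functions, and write $a_-=\max(-a,0)$ for real $a$. Then, for every $B>0$ and all $\omega_1,\omega_2,\mu>0$, the operator $H_B+V$ is self-adjoint, it has a unique bounded negative part $(H_B+V)_-$ (a bounded operator $N\ge 0$ with $H_B+V+N\ge 0$ and $(H_B+V+N)N=0$), and $$\operatorname{Tr}(H_B+V)_-\;\le\;\frac{B}{2\pi}\sum_{m=0}^\infty\int_{\mathbb R^2}\bigl((2m+1)B+V(x)\bigr)_-\,dx .$$ Moreover, the constant $1$ is sharp: for every $B>0$, if $\rho\in[0,\infty]$ is such that $$\operatorname{Tr}(H_B+V)_-\;\le\;\rho\,\frac{B}{2\pi}\sum_{m=0}^\infty\int_{\mathbb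 R^2}\bigl((2m+1)B+V(x)\bigr)_-\,dx$$ for all $\omega_1,\omega_2,\mu>0$ (with $V$ as above), then $\rho\ge 1$. -/

import Mathlib

open MeasureTheory
open scoped ENNReal SchwartzMap InnerProductSpace ContDiff

noncomputable section

/-- The configuration space `ℝ²`; the coordinates `x₁, x₂` are `x 0, x 1`. -/
abbrev Plane : Type := EuclideanSpace ℝ (Fin 2)

/-- The complex Hilbert space `L²(ℝ²)` (Lebesgue measure). -/
abbrev L2Plane : Type := Lp ℂ 2 (volume : Measure Plane)

/-- The partial derivative `∂u/∂x_{j+1}`. -/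
def partialDeriv (j : Fin 2) (u : Plane → ℂ) (x : Plane) : ℂ :=
  fderiv ℝ u x (EuclideanSpace.single j 1)

/-- `(-i ∂/∂x₁ + B x₂ / 2) u`. -/
def magMomentum₁ (B : ℝ) (u : Plane → ℂ) (x : Plane) : ℂ :=
  -Complex.I * partialDeriv 0 u x + ((B * x 1 / 2 : ℝ) : ℂ) * u x

/-- `(-i ∂/∂x₂ - B x₁ / 2) u`. -/
def magMomentum₂ (B : ℝ) (u : Plane → ℂ) (x : Plane) : ℂ :=
  -Complex.I * partialDeriv 1 u x - ((B * x 0 / 2 : ℝ) : ℂ) * u x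

/-- The differential expression of `H_B + V`, where
`H_B = (-i ∂/∂x₁ + B x₂ / 2)² + (-i ∂/∂x₂ - B x₁ / 2)²`. -/
def magSchrodingerExpr (B : ℝ) (V : Plane → ℝ) (u : Plane → ℂ) (x : Plane) : ℂ :=
  magMomentum₁ B (magMomentum₁ B u) x + magMomentum₂ B (magMomentum₂ B u) x + (V x : ℂ) * u x

lemma contDiff_magMomentum₁ (B : ℝ) {u : Plane → ℂ} (hu : ContDiff ℝ ∞ u) :
    ContDiff ℝ ∞ (magMomentum₁ B u) := by
  have h1 : ContDiff ℝ ∞ (fun x => fderiv ℝ u x (EuclideanSpace.single (0 : Fin 2) (1 : ℝ))) :=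
    (hu.fderiv_right (m := ∞) le_rfl).clm_apply contDiff_const
  have h2 : ContDiff ℝ ∞ (fun x : Plane => ((B * x 1 / 2 : ℝ) : ℂ)) :=
    Complex.ofRealCLM.contDiff.comp
      (((contDiff_const (c := B)).mul (by fun_prop : ContDiff ℝ ∞ fun x : Plane => x 1)).div_const 2)
  exact (contDiff_const.mul h1).add (h2.mul hu)

lemma contDiff_magMomentum₂ (B : ℝ) {u : Plane → ℂ} (hu : ContDiff ℝ ∞ u) :
    ContDiff ℝ ∞ (magMomentum₂ B u) := by
  have h1 : ContDiff ℝ ∞ (fun x => fderiv ℝ u x (EuclideanSpace.single (1 : Fin 2) (1 : ℝ))) :=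
    (hu.fderiv_right (m := ∞) le_rfl).clm_apply contDiff_const
  have h2 : ContDiff ℝ ∞ (fun x : Plane => ((B * x 0 / 2 : ℝ) : ℂ)) :=
    Complex.ofRealCLM.contDiff.comp
      (((contDiff_const (c := B)).mul (by fun_prop : ContDiff ℝ ∞ fun x : Plane => x 0)).div_const 2)
  exact (contDiff_const.mul h1).sub (h2.mul hu)

lemma partialDeriv_add (j : Fin 2) {u v : Plane → ℂ} (hu : ContDiff ℝ ∞ u)
    (hv : ContDiff ℝ ∞ v) : partialDeriv j (u + v) = partialDeriv j u + partialDeriv j v := by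
  ext x
  simp [partialDeriv, fderiv_add (hu.differentiable (by simp) x) (hv.differentiable (by simp) x)]

lemma partialDeriv_smul (j : Fin 2) (c : ℂ) {u : Plane → ℂ} (hu : ContDiff ℝ ∞ u) :
    partialDeriv j (c • u) = c • partialDeriv j u := by
  ext x
  simp [partialDeriv, fderiv_const_smul (hu.differentiable (by simp) x) c]

lemma magSchrodingerExpr_add (B : ℝ) (V : Plane → ℝ) {u v : Plane → ℂ} (hu : ContDiff ℝ ∞ u)
    (hv : ContDiff ℝ ∞ v) :
    magSchrodingerExpr B V (u + v) = magSchrodingerExpr B V u + magSchrodingerExpr B V v := by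
  have h1 : ∀ {u v : Plane → ℂ}, ContDiff ℝ ∞ u → ContDiff ℝ ∞ v →
      magMomentum₁ B (u + v) = magMomentum₁ B u + magMomentum₁ B v := by
    intro u v hu hv
    ext x
    simp only [magMomentum₁, partialDeriv_add 0 hu hv, Pi.add_apply]
    ring
  have h2 : ∀ {u v : Plane → ℂ}, ContDiff ℝ ∞ u → ContDiff ℝ ∞ v →
      magMomentum₂ B (u + v) = magMomentum₂ B u + magMomentum₂ B v := by
    intro u v hu hv
    ext x
    simp only [magMomentum₂, partialDeriv_add 1 hu hv, Pi.add_apply]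
    ring
  ext x
  simp only [magSchrodingerExpr, h1 hu hv, h2 hu hv,
    h1 (contDiff_magMomentum₁ B hu) (contDiff_magMomentum₁ B hv),
    h2 (contDiff_magMomentum₂ B hu) (contDiff_magMomentum₂ B hv), Pi.add_apply]
  ring

lemma magSchrodingerExpr_smul (B : ℝ) (V : Plane → ℝ) (c : ℂ) {u : Plane → ℂ}
    (hu : ContDiff ℝ ∞ u) :
    magSchrodingerExpr B V (c • u) = c • magSchrodingerExpr B V u := by
  have h1 : ∀ {u : Plane → ℂ}, ContDiff ℝ ∞ u →
      magMomentum₁ B (c • u) = c • magMomentum₁ B u := by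
    intro u hu
    ext x
    simp only [magMomentum₁, partialDeriv_smul 0 c hu, Pi.smul_apply, smul_eq_mul]
    ring
  have h2 : ∀ {u : Plane → ℂ}, ContDiff ℝ ∞ u →
      magMomentum₂ B (c • u) = c • magMomentum₂ B u := by
    intro u hu
    ext x
    simp only [magMomentum₂, partialDeriv_smul 1 c hu, Pi.smul_apply, smul_eq_mul]
    ring
  ext x
  simp only [magSchrodingerExpr, h1 hu, h2 hu, h1 (contDiff_magMomentum₁ B hu),
    h2 (contDiff_magMomentum₂ B hu), Pi.smul_apply, smul_eq_mul]
  ring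

/-- The graph of `H_B + V` on Schwartz functions: all pairs `(φ, (H_B + V) φ)` of elements of
`L²(ℝ²)` with `φ` a Schwartz function. For a polynomial `V`, every Schwartz function occurs. -/
def magSchrodingerGraph (B : ℝ) (V : Plane → ℝ) : Submodule ℂ (L2Plane × L2Plane) where
  carrier := {p | ∃ φ : 𝓢(Plane, ℂ), p.1 =ᵐ[volume] φ ∧
    p.2 =ᵐ[volume] magSchrodingerExpr B V φ}
  zero_mem' := by
    refine ⟨0, Lp.coeFn_zero _ _ _, ?_⟩
    have h := magSchrodingerExpr_smul B V 0 (u := 0) contDiff_const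
    simp only [zero_smul] at h
    have h0 : ((0 : 𝓢(Plane, ℂ)) : Plane → ℂ) = 0 := rfl
    rw [h0, h]
    exact Lp.coeFn_zero _ _ _
  add_mem' := by
    rintro p q ⟨φ, h1, h2⟩ ⟨ψ, h3, h4⟩
    refine ⟨φ + ψ, (Lp.coeFn_add _ _).trans (h1.add h3), ?_⟩
    have h0 : ((φ + ψ : 𝓢(Plane, ℂ)) : Plane → ℂ) = ⇑φ + ⇑ψ := rfl
    rw [h0, magSchrodingerExpr_add B V (φ.smooth ⊤) (ψ.smooth ⊤)]
    exact (Lp.coeFn_add _ _).trans (h2.add h4)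
  smul_mem' := by
    rintro c p ⟨φ, h1, h2⟩
    refine ⟨c • φ, (Lp.coeFn_smul _ _).trans (h1.const_smul c), ?_⟩
    have h0 : ((c • φ : 𝓢(Plane, ℂ)) : Plane → ℂ) = c • ⇑φ := rfl
    rw [h0, magSchrodingerExpr_smul B V c (φ.smooth ⊤)]
    exact (Lp.coeFn_smul _ _).trans (h2.const_smul c)

/-- The operator `H_B + V` in `L²(ℝ²)`: the closure of the differential operator defined on
Schwartz functions. -/
def magSchrodinger (B : ℝ) (V : Plane → ℝ) : L2Plane →ₗ.[ℂ] L2Plane :=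
  (magSchrodingerGraph B V).toLinearPMap.closure

/-- `N` is the negative part `A₋` of the self-adjoint, lower semibounded operator `A`: `N` is a
bounded nonnegative operator such that `A₊ := A + N` is nonnegative and `A₊ N = 0`. For
self-adjoint `A` these properties determine `N`. -/
structure IsNegPart {H : Type*} [NormedAddCommGroup H] [InnerProductSpace ℂ H]
    (A : H →ₗ.[ℂ] H) (N : H →L[ℂ] H) : Prop where
  isPositive : N.IsPositive
  add_nonneg : ∀ x : A.domain, 0 ≤ (⟪(x : H), A x + N x⟫_ℂ).re
  add_mul_eq_zero : ∀ x : H, ∃ h : N x ∈ A.domain, A ⟨N x, h⟩ + N (N x) = 0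

/-- The trace `∑ᵢ ⟨bᵢ, T bᵢ⟩ ∈ [0, ∞]` of a bounded nonnegative operator `T`, where `b` is an
orthonormal basis (on whose choice the value does not depend). -/
def posTrace {H : Type*} [NormedAddCommGroup H] [InnerProductSpace ℂ H] [CompleteSpace H]
    (T : H →L[ℂ] H) : ℝ≥0∞ :=
  ∑' b : (exists_hilbertBasis ℂ H).choose, ENNReal.ofReal (⟪(b : H), T b⟫_ℂ).re

/-- `Tr A₋`, the trace of the negative part of `A` (`∞` if `A` has no bounded negative part). -/
def negTrace {H : Type*} [NormedAddCommGroup H] [InnerProductSpace ℂ H] [CompleteSpace H]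
    (A : H →ₗ.[ℂ] H) : ℝ≥0∞ :=
  ⨅ (N : H →L[ℂ] H) (_ : IsNegPart A N), posTrace N

/-- `(B / 2π) ∑_{m ≥ 0} ∫ ((2m + 1) B + V(x))₋ dx`, where `a⁻ = max (-a) 0`. -/
def magSemiclassical (B : ℝ) (V : Plane → ℝ) : ℝ≥0∞ :=
  ENNReal.ofReal (B / (2 * Real.pi)) *
    ∑' m : ℕ, ∫⁻ x : Plane, ENNReal.ofReal (((2 * (m : ℝ) + 1) * B + V x)⁻)

/-- `V(x) = ω₁² x₁² + ω₂² x₂² - μ`. -/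
def oscPotential (ω₁ ω₂ μ : ℝ) (x : Plane) : ℝ :=
  ω₁ ^ 2 * x 0 ^ 2 + ω₂ ^ 2 * x 1 ^ 2 - μ

end

/-! The operator is quadratic in positions and momenta, so it is solved exactly by two normal modes.
With `ν ν' = ω₁ ω₂` and `ν² + ν'² = ω₁² + ω₂² + B²` its eigenvalues are `(2j+1)ν + (2k+1)ν' - μ`,
`j, k ≥ 0`, and the theorem becomes an inequality between sums.

Spectrum. Operators linear in `π₁, π₂, x₁, x₂` have scalar commutators with each other, and the
commutator with the Hamiltonian maps them linearly into themselves. The eigenvectors of that map are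
the ladder operators (`isLadderPair`), and both annihilation operators kill an explicit Gaussian.
The excited states are orthogonal by ladder algebra. They are complete because the coordinates are
combinations of ladder operators: the span of the states is then stable under multiplication by
polynomials, and a function orthogonal to all polynomials times a Gaussian vanishes
(`eq_zero_of_orthogonal`). A symmetric operator with a Hilbert basis of eigenvectors in its domain
has a diagonal, self-adjoint closure (`isDiagonal_closure`, `IsDiagonal.isSelfAdjoint`), whose
negative part can be read off from the eigenvalues.

Upper bound. For fixed `j`, the sum over `k` is a midpoint sum of a convex function, hence at most
its integral (`tsum_negPart_le`). Since `1/ν' = ν/(ω₁ω₂)`, this leaves `ν ∑ⱼ (μ - (2j+1)ν)₊² /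
(4ω₁ω₂)`. The semiclassical side is the same expression with `ν` replaced by `B`. The larger
frequency satisfies `ν ≥ B`, and `t ∑ⱼ (μ - (2j+1)t)₊²` is nonincreasing in `t`
(`mul_sum_posPart_sq_le`).

Sharpness. Take `μ = 2B`, between the first two Landau levels, and `ω₁ = ω₂ = w → 0`. Keeping only
`j = 0` already gives a trace asymptotic to the semiclassical value
(`one_le_of_forall_negTrace_le`). -/

noncomputable section

/-! ### Operators diagonal in a Hilbert basis -/

section Diagonal

variable {H : Type*} [NormedAddCommGroup H] [InnerProductSpace ℂ H] {ι : Type*}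

/-- `A` is the maximal operator which is diagonal in the basis `e` with real eigenvalues `ev`. -/
def IsDiagonal (e : HilbertBasis ι ℂ H) (ev : ι → ℝ) (A : H →ₗ.[ℂ] H) : Prop :=
  ∀ x y : H, (x, y) ∈ A.graph ↔ ∀ i, ⟪e i, y⟫_ℂ = ev i * ⟪e i, x⟫_ℂ

lemma HilbertBasis.ext_inner (e : HilbertBasis ι ℂ H) {x y : H}
    (h : ∀ i, ⟪e i, x⟫_ℂ = ⟪e i, y⟫_ℂ) : x = y := by
  apply e.repr.injective
  ext i
  simpa [e.repr_apply_apply] using h i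

lemma HilbertBasis.inner_self (e : HilbertBasis ι ℂ H) (i : ι) : ⟪e i, e i⟫_ℂ = 1 := by
  rw [inner_self_eq_norm_sq_to_K, e.orthonormal.1 i]; simp

lemma HilbertBasis.inner_ne (e : HilbertBasis ι ℂ H) {i j : ι} (h : i ≠ j) :
    ⟪e i, e j⟫_ℂ = 0 := e.orthonormal.2 h

/-- A symmetric graph that contains a Hilbert basis of eigenvectors has a diagonal closure. -/
theorem isDiagonal_closure [CompleteSpace H] (e : HilbertBasis ι ℂ H) (ev : ι → ℝ)
    (G : Submodule ℂ (H × H)) (he : ∀ i, (e i, (ev i : ℂ) • e i) ∈ G)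
    (hG : ∀ p ∈ G, ∀ q ∈ G, ⟪p.2, q.1⟫_ℂ = ⟪p.1, q.2⟫_ℂ) :
    IsDiagonal e ev G.toLinearPMap.closure := by
  have hsub : ∀ p ∈ G, ∀ i, ⟪e i, p.2⟫_ℂ = ev i * ⟪e i, p.1⟫_ℂ := by
    intro p hp i
    have := hG _ (he i) _ hp
    simp only [inner_smul_left, Complex.conj_ofReal] at this
    exact this.symm
  have hcl : ∀ p : H × H, p ∈ G.topologicalClosure ↔
      ∀ i, ⟪e i, p.2⟫_ℂ = ev i * ⟪e i, p.1⟫_ℂ := by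
    intro p
    constructor
    · intro hp i
      have hclosed : IsClosed {p : H × H | ⟪e i, p.2⟫_ℂ = ev i * ⟪e i, p.1⟫_ℂ} :=
        isClosed_eq (by fun_prop) (by fun_prop)
      exact closure_minimal (fun q hq => hsub q hq i) hclosed hp
    · intro hp
      have h1 := e.hasSum_repr p.1
      have h2 := e.hasSum_repr p.2
      have h3 := h1.prodMk h2
      -- Expanding both components in the basis, each pair of partial sums is a combination of the
      -- eigenpairs `(e i, ev i • e i)`, hence lies in `G`.
      refine mem_closure_of_tendsto h3 (Filter.Eventually.of_forall fun s => ?_)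
      refine Submodule.sum_mem _ fun i _ => ?_
      have : ((e.repr p.1 i • e i, e.repr p.2 i • e i) : H × H) =
          e.repr p.1 i • (e i, (ev i : ℂ) • e i) := by
        rw [e.repr_apply_apply, e.repr_apply_apply, hp i, Prod.smul_mk, smul_smul, mul_comm]
      rw [this]
      exact G.smul_mem _ (he i)
  have hfun : ∀ q ∈ G.topologicalClosure, q.1 = 0 → q.2 = 0 := by
    intro q hq h0
    refine e.ext_inner fun i => ?_
    rw [(hcl q).1 hq i, h0]; simp
  have hgraph : G.toLinearPMap.graph = G :=
    G.toLinearPMap_graph_eq fun x hx h0 => hfun x (G.le_topologicalClosure hx) h0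
  have hclosable : G.toLinearPMap.IsClosable := by
    refine ⟨G.topologicalClosure.toLinearPMap, ?_⟩
    rw [hgraph, Submodule.toLinearPMap_graph_eq _ hfun]
  intro x y
  rw [← hclosable.graph_closure_eq_closure_graph, hgraph, hcl]

namespace IsDiagonal

variable {e : HilbertBasis ι ℂ H} {ev : ι → ℝ} {A : H →ₗ.[ℂ] H}

lemma mem_domain_of (hA : IsDiagonal e ev A) {x y : H}
    (h : ∀ i, ⟪e i, y⟫_ℂ = ev i * ⟪e i, x⟫_ℂ) : ∃ hx : x ∈ A.domain, A ⟨x, hx⟩ = y := by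
  have := (hA x y).2 h
  rw [LinearPMap.mem_graph_iff] at this
  obtain ⟨z, rfl, hz⟩ := this
  exact ⟨z.2, hz⟩

lemma inner_apply (hA : IsDiagonal e ev A) (x : A.domain) (i : ι) :
    ⟪e i, A x⟫_ℂ = ev i * ⟪e i, (x : H)⟫_ℂ :=
  (hA x (A x)).1 (A.mem_graph x) i

lemma apply_basis (hA : IsDiagonal e ev A) (i : ι) :
    ∃ hx : e i ∈ A.domain, A ⟨e i, hx⟩ = (ev i : ℂ) • e i := by
  classical
  refine hA.mem_domain_of fun j => ?_
  rw [inner_smul_right]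
  by_cases h : j = i
  · rw [h]
  · rw [e.inner_ne h]; simp

/-- The adjoint graph obeys the same coefficient condition: testing against each `e i` gives one
inclusion, Parseval's identity the other. -/
theorem isSelfAdjoint [CompleteSpace H] (hA : IsDiagonal e ev A) : IsSelfAdjoint A := by
  have hdense : Dense (A.domain : Set H) := by
    have h := e.dense_span
    have hle : Submodule.span ℂ (Set.range e) ≤ A.domain := by
      rw [Submodule.span_le]
      rintro _ ⟨i, rfl⟩
      exact (hA.apply_basis i).1
    have : A.domain.topologicalClosure = ⊤ :=
      top_le_iff.1 (h ▸ Submodule.topologicalClosure_mono hle)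
    exact Submodule.dense_iff_topologicalClosure_eq_top.2 this
  rw [LinearPMap.isSelfAdjoint_def]
  apply LinearPMap.eq_of_eq_graph
  rw [LinearPMap.adjoint_graph_eq_graph_adjoint hdense]
  ext ⟨y, z⟩
  rw [Submodule.mem_adjoint_iff, hA]
  constructor
  · intro h i
    obtain ⟨hx, hxe⟩ := hA.apply_basis i
    have h1 := h (e i) _ (A.mem_graph ⟨e i, hx⟩)
    rw [hxe, inner_smul_left, Complex.conj_ofReal] at h1
    exact (sub_eq_zero.1 h1).symm
  · intro h a b hab
    have hab' := (hA a b).1 hab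
    rw [← e.tsum_inner_mul_inner b y, ← e.tsum_inner_mul_inner a z, sub_eq_zero]
    congr 1
    ext i
    rw [h i, ← inner_conj_symm b, hab' i, ← inner_conj_symm a]
    simp only [map_mul, Complex.conj_ofReal]
    ring

end IsDiagonal

/-- The finite-rank operator `∑_{i ∈ s} c i |e i⟩⟨e i|`. -/
def diagonalOp (e : HilbertBasis ι ℂ H) (s : Finset ι) (c : ι → ℝ) : H →L[ℂ] H :=
  ∑ i ∈ s, (c i : ℂ) • (innerSL ℂ (e i)).smulRight (e i)

lemma diagonalOp_apply (e : HilbertBasis ι ℂ H) (s : Finset ι) (c : ι → ℝ) (x : H) :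
    diagonalOp e s c x = ∑ i ∈ s, ((c i : ℂ) * ⟪e i, x⟫_ℂ) • e i := by
  simp [diagonalOp, mul_smul]

lemma inner_diagonalOp (e : HilbertBasis ι ℂ H) {s : Finset ι} {c : ι → ℝ}
    (hs : ∀ i, i ∉ s → c i = 0) (x : H) (j : ι) :
    ⟪e j, diagonalOp e s c x⟫_ℂ = c j * ⟪e j, x⟫_ℂ := by
  classical
  rw [diagonalOp_apply, inner_sum]
  by_cases hj : j ∈ s
  · rw [Finset.sum_eq_single_of_mem j hj]
    · rw [inner_smul_right, e.inner_self, mul_one]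
    · intro i _ hij
      rw [inner_smul_right, e.inner_ne hij.symm, mul_zero]
  · rw [hs j hj, Finset.sum_eq_zero]
    · simp
    · intro i hi
      rw [inner_smul_right, e.inner_ne (by rintro rfl; exact hj hi), mul_zero]

lemma inner_self_diagonalOp (e : HilbertBasis ι ℂ H) (s : Finset ι) (c : ι → ℝ) (x : H) :
    ⟪x, diagonalOp e s c x⟫_ℂ = ((∑ i ∈ s, c i * ‖⟪e i, x⟫_ℂ‖ ^ 2 : ℝ) : ℂ) := by
  rw [diagonalOp_apply, inner_sum]
  push_cast
  refine Finset.sum_congr rfl fun i _ => ?_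
  rw [inner_smul_right, ← inner_conj_symm x, mul_assoc, RCLike.mul_conj]
  rfl

lemma diagonalOp_isPositive [CompleteSpace H] (e : HilbertBasis ι ℂ H) (s : Finset ι) {c : ι → ℝ}
    (hc : ∀ i, 0 ≤ c i) : (diagonalOp e s c).IsPositive := by
  rw [ContinuousLinearMap.isPositive_iff_complex]
  intro x
  rw [← inner_conj_symm, inner_self_diagonalOp]
  simp only [Complex.conj_ofReal, RCLike.re_to_complex, Complex.ofReal_re]
  exact ⟨trivial, Finset.sum_nonneg fun i _ => mul_nonneg (hc i) (sq_nonneg _)⟩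

namespace IsDiagonal

variable {e : HilbertBasis ι ℂ H} {ev : ι → ℝ} {A : H →ₗ.[ℂ] H}

/-- Existence of the negative part of a diagonal operator with finitely many negative
eigenvalues. -/
theorem isNegPart_diagonalOp [CompleteSpace H] (hA : IsDiagonal e ev A) {s : Finset ι}
    (hs : ∀ i, i ∉ s → 0 ≤ ev i) : IsNegPart A (diagonalOp e s fun i => (ev i)⁻) where
  isPositive := diagonalOp_isPositive e s fun i => negPart_nonneg _
  add_nonneg := by
    intro x
    have hs' : ∀ i, i ∉ s → (ev i)⁻ = 0 := fun i hi => negPart_eq_zero.2 (hs i hi)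
    have h := e.hasSum_inner_mul_inner (x : H) (A x + diagonalOp e s (fun i => (ev i)⁻) x)
    refine (Complex.hasSum_re h).nonneg fun i => ?_
    rw [inner_add_right, hA.inner_apply, inner_diagonalOp e hs', ← add_mul, mul_left_comm,
      ← inner_conj_symm (x : H) (e i), Complex.conj_mul', ← Complex.ofReal_add]
    have : ev i + (ev i)⁻ = (ev i)⁺ := by
      linarith [posPart_sub_negPart (ev i)]
    rw [this, ← Complex.ofReal_pow, ← Complex.ofReal_mul, Complex.ofReal_re]
    have h2 := mul_nonneg (posPart_nonneg (ev i)) (sq_nonneg ‖⟪e i, (x : H)⟫_ℂ‖)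
    exact h2
  add_mul_eq_zero := by
    intro x
    have hs' : ∀ i, i ∉ s → (ev i)⁻ = 0 := fun i hi => negPart_eq_zero.2 (hs i hi)
    set N := diagonalOp e s (fun i => (ev i)⁻)
    obtain ⟨h, h2⟩ := hA.mem_domain_of (x := N x) (y := -N (N x)) fun i => by
      rw [inner_neg_right, inner_diagonalOp e hs', inner_diagonalOp e hs', ← mul_assoc,
        ← mul_assoc, ← neg_mul]
      congr 1
      norm_cast
      rcases le_total 0 (ev i) with h | h
      · simp [negPart_eq_zero.2 h]
      · simp [negPart_of_nonpos h]
    exact ⟨h, by rw [h2]; simp⟩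

/-- A negative part acts on an eigenvector by the negative part of the eigenvalue. -/
theorem negPart_apply_basis [CompleteSpace H] (hA : IsDiagonal e ev A) {N : H →L[ℂ] H}
    (hN : IsNegPart A N) (i : ι) : N (e i) = (((ev i)⁻ : ℝ) : ℂ) • e i := by
  obtain ⟨hd, hAe⟩ := hA.apply_basis i
  have hsym : ∀ x y, ⟪N x, y⟫_ℂ = ⟪x, N y⟫_ℂ := fun x y => hN.isPositive.isSymmetric x y
  -- This is the adjoint form of `A N = -N²`, tested on the eigenvector.
  have hquad : N (N (e i)) = -((ev i : ℂ) • N (e i)) := by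
    refine ext_inner_right ℂ fun y => ?_
    obtain ⟨h, h2⟩ := hN.add_mul_eq_zero y
    have h3 := hA.inner_apply ⟨N y, h⟩ i
    rw [eq_neg_of_add_eq_zero_left h2] at h3
    rw [inner_neg_left, inner_smul_left, Complex.conj_ofReal, hsym, hsym, hsym, ← h3,
      inner_neg_right, neg_neg]
  have hpos : ∀ x, 0 ≤ (⟪x, N x⟫_ℂ).re := fun x => by
    have := (ContinuousLinearMap.isPositive_iff_complex N).1 hN.isPositive x
    rw [← hsym]
    exact this.2
  have hnorm : ∀ x : H, (⟪x, x⟫_ℂ).re = ‖x‖ ^ 2 := fun x => by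
    rw [inner_self_eq_norm_sq_to_K]; norm_cast
  rcases lt_trichotomy (ev i) 0 with h | h | h
  -- The vector `w` lies in the kernel of `N` and is an eigenvector of `A` for a negative
  -- eigenvalue, so nonnegativity of `A + N` forces `w = 0`.
  · set w := N (e i) + (ev i : ℂ) • e i with hw
    have hNw : N w = 0 := by rw [hw, map_add, map_smul, hquad]; simp
    obtain ⟨h1, h2⟩ := hN.add_mul_eq_zero (e i)
    have hwd : w ∈ A.domain := A.domain.add_mem h1 (A.domain.smul_mem _ hd)
    have hAw : A ⟨w, hwd⟩ = (ev i : ℂ) • w := by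
      have : (⟨w, hwd⟩ : A.domain) = ⟨N (e i), h1⟩ + (ev i : ℂ) • ⟨e i, hd⟩ := rfl
      rw [this, LinearPMap.map_add, LinearPMap.map_smul, hAe, eq_neg_of_add_eq_zero_left h2, hquad, neg_neg, ← smul_add]
    have h3 := hN.add_nonneg ⟨w, hwd⟩
    rw [hAw, hNw, add_zero, inner_smul_right, Complex.re_ofReal_mul, hnorm] at h3
    have hw0 : w = 0 := by
      by_contra hne
      have : 0 < ‖w‖ ^ 2 := by positivity
      nlinarith
    rw [negPart_of_nonpos h.le, eq_neg_of_add_eq_zero_left (hw.symm.trans hw0)]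
    simp
  · have h1 : ⟪N (e i), N (e i)⟫_ℂ = 0 := by
      rw [hsym, hquad, h]; simp
    rw [inner_self_eq_zero.1 h1, h]; simp
  · have h3 := hpos (N (e i))
    rw [hquad, inner_neg_right, inner_smul_right, Complex.neg_re, Complex.re_ofReal_mul,
      hnorm] at h3
    have hw0 : N (e i) = 0 := by
      by_contra hne
      have : 0 < ‖N (e i)‖ ^ 2 := by positivity
      nlinarith
    rw [hw0, negPart_eq_zero.2 h.le]; simp

theorem negPart_unique [CompleteSpace H] (hA : IsDiagonal e ev A) {N N' : H →L[ℂ] H}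
    (hN : IsNegPart A N) (hN' : IsNegPart A N') : N = N' := by
  refine ContinuousLinearMap.ext_on (s := Set.range e) ?_ ?_
  · exact Submodule.dense_iff_topologicalClosure_eq_top.2 e.dense_span
  · rintro _ ⟨i, rfl⟩
    rw [hA.negPart_apply_basis hN, hA.negPart_apply_basis hN']

end IsDiagonal

/-- After exchanging the sums, Parseval's identity for each `e i` in the basis chosen by `posTrace`
makes that choice irrelevant. -/
theorem posTrace_diagonalOp [CompleteSpace H] (e : HilbertBasis ι ℂ H) (s : Finset ι) {c : ι → ℝ}
    (hc : ∀ i, 0 ≤ c i) : posTrace (diagonalOp e s c) = ∑ i ∈ s, ENNReal.ofReal (c i) := by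
  obtain ⟨b, hb⟩ := (exists_hilbertBasis ℂ H).choose_spec
  have h1 : ∀ v : (exists_hilbertBasis ℂ H).choose,
      ENNReal.ofReal (⟪(v : H), diagonalOp e s c v⟫_ℂ).re =
        ∑ i ∈ s, ENNReal.ofReal (c i) * ENNReal.ofReal (‖⟪e i, (v : H)⟫_ℂ‖ ^ 2) := by
    intro v
    rw [inner_self_diagonalOp, Complex.ofReal_re, ENNReal.ofReal_sum_of_nonneg]
    · exact Finset.sum_congr rfl fun i _ => ENNReal.ofReal_mul (hc i)
    · exact fun i _ => mul_nonneg (hc i) (sq_nonneg _)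
  rw [posTrace, tsum_congr h1, Summable.tsum_finsetSum fun _ _ => ENNReal.summable]
  refine Finset.sum_congr rfl fun i _ => ?_
  rw [ENNReal.tsum_mul_left]
  have h2 : HasSum (fun v : (exists_hilbertBasis ℂ H).choose => ‖⟪e i, (v : H)⟫_ℂ‖ ^ 2) 1 := by
    have := Complex.hasSum_re (b.hasSum_inner_mul_inner (e i) (e i))
    rw [e.inner_self, Complex.one_re] at this
    convert this using 2 with v
    rw [hb, ← inner_conj_symm (v : H) (e i), RCLike.mul_conj]
    norm_cast
  rw [← ENNReal.ofReal_tsum_of_nonneg (fun _ => sq_nonneg _) h2.summable, h2.tsum_eq]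
  simp

theorem IsDiagonal.existsUnique_isNegPart [CompleteSpace H] {e : HilbertBasis ι ℂ H} {ev : ι → ℝ}
    {A : H →ₗ.[ℂ] H} (hA : IsDiagonal e ev A) {s : Finset ι} (hs : ∀ i, i ∉ s → 0 ≤ ev i) :
    ∃! N : H →L[ℂ] H, IsNegPart A N :=
  ⟨_, hA.isNegPart_diagonalOp hs, fun _ h => hA.negPart_unique h (hA.isNegPart_diagonalOp hs)⟩

/-- Uniqueness of the negative part reduces the infimum defining `negTrace` to a single term. -/
theorem IsDiagonal.negTrace_eq [CompleteSpace H] {e : HilbertBasis ι ℂ H} {ev : ι → ℝ}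
    {A : H →ₗ.[ℂ] H} (hA : IsDiagonal e ev A) {s : Finset ι} (hs : ∀ i, i ∉ s → 0 ≤ ev i) :
    negTrace A = ∑' i, ENNReal.ofReal ((ev i)⁻) := by
  have hN := hA.isNegPart_diagonalOp hs
  rw [tsum_eq_sum (s := s) fun i hi => by simp [negPart_eq_zero.2 (hs i hi)],
    ← posTrace_diagonalOp e s fun i => negPart_nonneg (ev i)]
  refine le_antisymm (iInf₂_le _ hN) (le_iInf₂ fun N' hN' => ?_)
  rw [hA.negPart_unique hN' hN]

end Diagonal

end

noncomputable section

/-! ### Two commuting pairs of ladder operators -/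

section Ladder

variable {V H : Type*} [AddCommGroup V] [Module ℂ V] [NormedAddCommGroup H]
  [InnerProductSpace ℂ H]

/-- Two commuting pairs `(a, a')`, `(b, b')` of annihilation and creation operators, mutually
adjoint for the inner product pulled back along `T`, with the common vacuum vector `v`. -/
structure IsLadderPair (T : V →ₗ[ℂ] H) (a a' b b' : Module.End ℂ V) (ca cb : ℝ) (v : V) :
    Prop where
  ca_pos : 0 < ca
  cb_pos : 0 < cb
  lie_a : a * a' = a' * a + (ca : ℂ) • 1
  lie_b : b * b' = b' * b + (cb : ℂ) • 1
  comm : Commute a' b'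
  comm_a : Commute a b'
  comm_b : Commute b a'
  adj_a : ∀ u w, ⟪T (a u), T w⟫_ℂ = ⟪T u, T (a' w)⟫_ℂ
  adj_b : ∀ u w, ⟪T (b u), T w⟫_ℂ = ⟪T u, T (b' w)⟫_ℂ
  vac_a : a v = 0
  vac_b : b v = 0
  vac_ne : T v ≠ 0

/-- The excited states `a'ʲ b'ᵏ v`. -/
def ladderState (a' b' : Module.End ℂ V) (v : V) (p : ℕ × ℕ) : V := (a' ^ p.1 * b' ^ p.2) v

variable {T : V →ₗ[ℂ] H} {a a' b b' : Module.End ℂ V} {ca cb : ℝ} {v : V}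

lemma mul_pow_of_lie (h : a * a' = a' * a + (ca : ℂ) • 1) (j : ℕ) :
    a * a' ^ (j + 1) = a' ^ (j + 1) * a + ((j + 1 : ℂ) * ca) • a' ^ j := by
  induction j with
  | zero => simp [h]
  | succ j ih =>
    rw [pow_succ a' (j + 1), ← mul_assoc, ih, add_mul, mul_assoc, h, mul_add, smul_mul_assoc,
      ← pow_succ, ← mul_assoc]
    push_cast
    rw [mul_smul_comm, mul_one]
    module

namespace IsLadderPair

lemma swap (h : IsLadderPair T a a' b b' ca cb v) : IsLadderPair T b b' a a' cb ca v where
  ca_pos := h.cb_pos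
  cb_pos := h.ca_pos
  lie_a := h.lie_b
  lie_b := h.lie_a
  comm := h.comm.symm
  comm_a := h.comm_b
  comm_b := h.comm_a
  adj_a := h.adj_b
  adj_b := h.adj_a
  vac_a := h.vac_b
  vac_b := h.vac_a
  vac_ne := h.vac_ne

lemma ladderState_swap (h : IsLadderPair T a a' b b' ca cb v) (j k : ℕ) :
    ladderState b' a' v (k, j) = ladderState a' b' v (j, k) := by
  rw [ladderState, ladderState, (h.comm.symm.pow_pow k j).eq]

lemma raise_a (j k : ℕ) :
    a' (ladderState a' b' v (j, k)) = ladderState a' b' v (j + 1, k) := by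
  simp [ladderState, pow_succ']

lemma raise_b (h : IsLadderPair T a a' b b' ca cb v) (j k : ℕ) :
    b' (ladderState a' b' v (j, k)) = ladderState a' b' v (j, k + 1) := by
  rw [← h.ladderState_swap, raise_a, h.ladderState_swap]

/-- At `j = 0` the truncated index `j - 1` is harmless because the coefficient vanishes. -/
lemma lower_a (h : IsLadderPair T a a' b b' ca cb v) (j k : ℕ) :
    a (ladderState a' b' v (j, k)) = ((j : ℂ) * ca) • ladderState a' b' v (j - 1, k) := by
  have h0 : a ((b' ^ k) v) = 0 := by
    rw [← Module.End.mul_apply, (h.comm_a.pow_right k).eq, Module.End.mul_apply, h.vac_a, map_zero]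
  cases j with
  | zero => simp [ladderState, h0]
  | succ j =>
    simp only [ladderState]
    rw [← Module.End.mul_apply, ← mul_assoc, mul_pow_of_lie h.lie_a, Module.End.mul_apply,
      LinearMap.add_apply, Module.End.mul_apply, h0, map_zero, zero_add]
    simp

lemma lower_b (h : IsLadderPair T a a' b b' ca cb v) (j k : ℕ) :
    b (ladderState a' b' v (j, k)) = ((k : ℂ) * cb) • ladderState a' b' v (j, k - 1) := by
  rw [← h.ladderState_swap, h.swap.lower_a, h.ladderState_swap]

/-- The number operator `a' a` is symmetric and has the states as eigenvectors with eigenvalue `j *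
ca`; different eigenvalues give orthogonality. -/
lemma inner_eq_zero_of_fst_ne (h : IsLadderPair T a a' b b' ca cb v) {j k j' k' : ℕ}
    (hj : j ≠ j') :
    ⟪T (ladderState a' b' v (j, k)), T (ladderState a' b' v (j', k'))⟫_ℂ = 0 := by
  have key : ∀ u w, ⟪T (a' (a u)), T w⟫_ℂ = ⟪T u, T (a' (a w))⟫_ℂ := by
    intro u w
    rw [← h.adj_a u, ← inner_conj_symm, ← h.adj_a w, inner_conj_symm]
  have num : ∀ j k, a' (a (ladderState a' b' v (j, k))) =
      ((j : ℂ) * ca) • ladderState a' b' v (j, k) := by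
    intro j k
    rw [h.lower_a, map_smul, raise_a]
    cases j with
    | zero => simp
    | succ j => simp
  have h1 := key (ladderState a' b' v (j, k)) (ladderState a' b' v (j', k'))
  rw [num, num, map_smul, map_smul, inner_smul_left, inner_smul_right] at h1
  have hc : (ca : ℂ) ≠ 0 := by exact_mod_cast h.ca_pos.ne'
  have hjj : (j : ℂ) - j' ≠ 0 := sub_ne_zero.2 (by exact_mod_cast hj)
  simp only [map_mul, Complex.conj_ofReal, Complex.conj_natCast] at h1
  have : ((j : ℂ) - j') * ca *
      ⟪T (ladderState a' b' v (j, k)), T (ladderState a' b' v (j', k'))⟫_ℂ = 0 := by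
    linear_combination h1
  simpa [hc, hjj] using this

lemma inner_eq_zero (h : IsLadderPair T a a' b b' ca cb v) {p q : ℕ × ℕ} (hpq : p ≠ q) :
    ⟪T (ladderState a' b' v p), T (ladderState a' b' v q)⟫_ℂ = 0 := by
  obtain ⟨j, k⟩ := p
  obtain ⟨j', k'⟩ := q
  by_cases hj : j = j'
  · have hk : k ≠ k' := fun hk => hpq (by rw [hj, hk])
    rw [← h.ladderState_swap, ← h.ladderState_swap]
    exact h.swap.inner_eq_zero_of_fst_ne hk
  · exact h.inner_eq_zero_of_fst_ne hj

/-- If raising annihilated a state, pairing with that state and using `a a'ʲ⁺¹ = a'ʲ⁺¹ a + (j+1) ca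
a'ʲ` would make its own norm zero. -/
lemma ne_zero_fst (h : IsLadderPair T a a' b b' ca cb v) (j k : ℕ)
    (h0 : T (ladderState a' b' v (0, k)) ≠ 0) : T (ladderState a' b' v (j, k)) ≠ 0 := by
  induction j with
  | zero => exact h0
  | succ j ih =>
    intro hz
    have h1 := h.adj_a (ladderState a' b' v (j + 1, k)) (ladderState a' b' v (j, k))
    rw [raise_a, hz, inner_zero_left, h.lower_a, map_smul, inner_smul_left] at h1
    have hc : (ca : ℂ) ≠ 0 := by exact_mod_cast h.ca_pos.ne'
    have hj : ((j + 1 : ℕ) : ℂ) ≠ 0 := by exact_mod_cast j.succ_ne_zero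
    simp only [map_mul, Complex.conj_ofReal, Complex.conj_natCast, mul_eq_zero, hc, hj,
      or_self, false_or, Nat.add_sub_cancel, inner_self_eq_zero] at h1
    exact ih h1

lemma ne_zero (h : IsLadderPair T a a' b b' ca cb v) (p : ℕ × ℕ) :
    T (ladderState a' b' v p) ≠ 0 := by
  obtain ⟨j, k⟩ := p
  refine h.ne_zero_fst j k ?_
  rw [← h.ladderState_swap]
  refine h.swap.ne_zero_fst k 0 ?_
  simpa [ladderState] using h.vac_ne

/-- The normalized excited states. -/
def normalizedState (T : V →ₗ[ℂ] H) (a' b' : Module.End ℂ V) (v : V) (p : ℕ × ℕ) : V :=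
  ((‖T (ladderState a' b' v p)‖⁻¹ : ℝ) : ℂ) • ladderState a' b' v p

lemma orthonormal (h : IsLadderPair T a a' b b' ca cb v) :
    Orthonormal ℂ fun p => T (normalizedState T a' b' v p) := by
  constructor
  · intro p
    simp only [normalizedState, map_smul, norm_smul, Complex.norm_real, norm_inv, norm_norm]
    exact inv_mul_cancel₀ (norm_ne_zero_iff.2 (h.ne_zero p))
  · intro p q hpq
    simp only [normalizedState, map_smul, inner_smul_left, inner_smul_right, h.inner_eq_zero hpq,
      mul_zero]

lemma span_invariant (h : IsLadderPair T a a' b b' ca cb v) :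
    (∀ u ∈ Submodule.span ℂ (Set.range (ladderState a' b' v)),
      a u ∈ Submodule.span ℂ (Set.range (ladderState a' b' v)) ∧
      a' u ∈ Submodule.span ℂ (Set.range (ladderState a' b' v)) ∧
      b u ∈ Submodule.span ℂ (Set.range (ladderState a' b' v)) ∧
      b' u ∈ Submodule.span ℂ (Set.range (ladderState a' b' v))) := by
  set W := Submodule.span ℂ (Set.range (ladderState a' b' v)) with hW
  have hmem : ∀ j k, ladderState a' b' v (j, k) ∈ W := fun j k =>
    Submodule.subset_span ⟨(j, k), rfl⟩
  have hle : W ≤ W.comap a ⊓ W.comap a' ⊓ W.comap b ⊓ W.comap b' := by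
    conv_lhs => rw [hW]
    rw [Submodule.span_le]
    rintro _ ⟨⟨j, k⟩, rfl⟩
    refine ⟨⟨⟨?_, ?_⟩, ?_⟩, ?_⟩ <;> simp only [Submodule.mem_comap, SetLike.mem_coe]
    · rw [h.lower_a]; exact W.smul_mem _ (hmem _ _)
    · rw [raise_a]; exact hmem _ _
    · rw [h.lower_b]; exact W.smul_mem _ (hmem _ _)
    · rw [h.raise_b]; exact hmem _ _
  intro u hu
  obtain ⟨⟨⟨h1, h2⟩, h3⟩, h4⟩ := hle hu
  exact ⟨h1, h2, h3, h4⟩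

lemma apply_normalizedState_mem (h : IsLadderPair T a a' b b' ca cb v) :
    ∀ u ∈ Submodule.span ℂ (Set.range (ladderState a' b' v)),
      T u ∈ Submodule.span ℂ (Set.range fun p => T (normalizedState T a' b' v p)) := by
  set W := Submodule.span ℂ (Set.range fun p => T (normalizedState T a' b' v p))
  have hle : Submodule.span ℂ (Set.range (ladderState a' b' v)) ≤ W.comap T := by
    rw [Submodule.span_le]
    rintro _ ⟨p, rfl⟩
    have h1 : T (normalizedState T a' b' v p) ∈ W := Submodule.subset_span ⟨p, rfl⟩
    have h2 := W.smul_mem ((‖T (ladderState a' b' v p)‖ : ℝ) : ℂ) h1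
    have hne : ((‖T (ladderState a' b' v p)‖ : ℝ) : ℂ) ≠ 0 := by
      exact_mod_cast norm_ne_zero_iff.2 (h.ne_zero p)
    rw [normalizedState, map_smul, smul_smul, Complex.ofReal_inv, mul_inv_cancel₀ hne,
      one_smul] at h2
    exact h2
  exact hle

end IsLadderPair

/-- An operator for which `a'`, `b'` raise the energy by `ea`, `eb` has all `ladderState`s as
eigenvectors. -/
lemma ladderState_eigen {K : Module.End ℂ V} {ea eb e0 : ℂ} (ha : K * a' = a' * K + ea • a')
    (hb : K * b' = b' * K + eb • b') (h0 : K v = e0 • v) (p : ℕ × ℕ) :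
    K (ladderState a' b' v p) = (e0 + p.1 * ea + p.2 * eb) • ladderState a' b' v p := by
  have step : ∀ (c : Module.End ℂ V) (ec : ℂ), K * c = c * K + ec • c → ∀ (u : V) (e : ℂ),
      K u = e • u → ∀ n : ℕ, K ((c ^ n) u) = (e + n * ec) • (c ^ n) u := by
    intro c ec hc u e hu n
    induction n with
    | zero => simpa using hu
    | succ n ih =>
      rw [pow_succ', Module.End.mul_apply, ← Module.End.mul_apply, hc, LinearMap.add_apply,
        Module.End.mul_apply, ih, LinearMap.smul_apply, map_smul, ← add_smul]
      congr 1
      push_cast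
      ring
  obtain ⟨j, k⟩ := p
  have h1 := step b' eb hb v e0 h0 k
  have h2 := step a' ea ha _ _ h1 j
  rw [ladderState, Module.End.mul_apply, h2]
  congr 1
  ring

end Ladder

end

noncomputable section

/-! ### Position and momentum operators on Schwartz functions -/

section SchwartzOps

open scoped LineDeriv ComplexConjugate

lemma hasTemperateGrowth_coord (j : Fin 2) :
    (fun x : Plane => ((x j : ℝ) : ℂ)).HasTemperateGrowth :=
  (Complex.ofRealCLM.comp (EuclideanSpace.proj (𝕜 := ℝ) j)).hasTemperateGrowth

/-- Multiplication by the coordinate `x j`. -/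
def posOp (j : Fin 2) : Module.End ℂ 𝓢(Plane, ℂ) :=
  (SchwartzMap.smulLeftCLM ℂ (fun x : Plane => ((x j : ℝ) : ℂ))).toLinearMap

/-- The partial derivative on Schwartz functions. -/
def derivOp (j : Fin 2) : Module.End ℂ 𝓢(Plane, ℂ) :=
  (LineDeriv.lineDerivOpCLM ℂ 𝓢(Plane, ℂ) (EuclideanSpace.single j (1 : ℝ))).toLinearMap

lemma posOp_apply (j : Fin 2) (f : 𝓢(Plane, ℂ)) (x : Plane) : posOp j f x = (x j : ℂ) * f x :=
  SchwartzMap.smulLeftCLM_apply_apply (hasTemperateGrowth_coord j) f x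

lemma derivOp_apply (j : Fin 2) (f : 𝓢(Plane, ℂ)) (x : Plane) :
    derivOp j f x = partialDeriv j f x := rfl

lemma derivOp_mul_posOp (j k : Fin 2) :
    derivOp j * posOp k = posOp k * derivOp j + (if j = k then (1 : ℂ) else 0) • 1 := by
  ext f x
  have hc : HasFDerivAt (fun x : Plane => ((x k : ℝ) : ℂ))
      (Complex.ofRealCLM.comp (EuclideanSpace.proj (𝕜 := ℝ) k)) x :=
    (Complex.ofRealCLM.comp (EuclideanSpace.proj (𝕜 := ℝ) k)).hasFDerivAt
  have h1 : HasFDerivAt (posOp k f) _ x :=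
    (hc.mul (f.hasFDerivAt x)).congr_of_eventuallyEq
      (Filter.Eventually.of_forall fun y => posOp_apply k f y)
  have h2 : derivOp j (posOp k f) x = (x k : ℂ) * derivOp j f x +
      f x * ((EuclideanSpace.single j (1 : ℝ) : Plane) k : ℂ) := by
    rw [derivOp_apply, derivOp_apply, partialDeriv, partialDeriv, h1.fderiv]
    simp
  change derivOp j (posOp k f) x = posOp k (derivOp j f) x + _
  rw [h2, posOp_apply]
  congr 1
  by_cases h : j = k
  · subst h; simp
  · simp [h, Ne.symm h]

lemma posOp_mul_comm (j k : Fin 2) : posOp j * posOp k = posOp k * posOp j := by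
  ext f x
  change posOp j (posOp k f) x = posOp k (posOp j f) x
  simp only [posOp_apply]
  ring

lemma derivOp_mul_comm (j k : Fin 2) : derivOp j * derivOp k = derivOp k * derivOp j := by
  ext f x
  change derivOp j (derivOp k f) x = derivOp k (derivOp j f) x
  have hd : ∀ j k : Fin 2, derivOp j (derivOp k f) x =
      fderiv ℝ (fderiv ℝ f) x (EuclideanSpace.single j 1) (EuclideanSpace.single k 1) := by
    intro j k
    have hdiff : DifferentiableAt ℝ (fderiv ℝ f) x :=
      (((f.smooth 2).fderiv_right (m := 1) (by norm_num)).differentiable (by simp)) x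
    change fderiv ℝ (fun y => fderiv ℝ f y (EuclideanSpace.single k 1)) x _ = _
    rw [fderiv_clm_apply hdiff (differentiableAt_const _)]
    simp
  rw [hd, hd]
  exact ((f.smooth 2).contDiffAt.isSymmSndFDerivAt (by simp)).eq _ _

/-- The embedding of Schwartz functions into `L²`. -/
def schwartzToL2 : 𝓢(Plane, ℂ) →ₗ[ℂ] L2Plane :=
  (SchwartzMap.toLpCLM ℂ ℂ 2 (volume : Measure Plane)).toLinearMap

lemma coeFn_schwartzToL2 (f : 𝓢(Plane, ℂ)) : schwartzToL2 f =ᵐ[volume] f :=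
  f.coeFn_toLp 2 volume

lemma inner_schwartzToL2 (f g : 𝓢(Plane, ℂ)) :
    ⟪schwartzToL2 f, schwartzToL2 g⟫_ℂ = ∫ x, conj (f x) * g x := by
  have h := SchwartzMap.inner_toL2_toL2_eq f g volume
  simp only [RCLike.inner_apply, mul_comm (g _)] at h
  exact h

lemma posOp_adj (j : Fin 2) (f g : 𝓢(Plane, ℂ)) :
    ⟪schwartzToL2 (posOp j f), schwartzToL2 g⟫_ℂ =
      ⟪schwartzToL2 f, schwartzToL2 (posOp j g)⟫_ℂ := by
  rw [inner_schwartzToL2, inner_schwartzToL2]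
  congr 1
  ext x
  rw [posOp_apply, posOp_apply, map_mul, Complex.conj_ofReal]
  ring

lemma derivOp_adj (j : Fin 2) (f g : 𝓢(Plane, ℂ)) :
    ⟪schwartzToL2 (derivOp j f), schwartzToL2 g⟫_ℂ =
      -⟪schwartzToL2 f, schwartzToL2 (derivOp j g)⟫_ℂ := by
  rw [inner_schwartzToL2, inner_schwartzToL2]
  have h := SchwartzMap.integral_bilinear_lineDerivOp_right_eq_neg_left (μ := volume) f g
    ((ContinuousLinearMap.mul ℝ ℂ) ∘L (Complex.conjCLE : ℂ →L[ℝ] ℂ)) (EuclideanSpace.single j 1)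
  simp only [ContinuousLinearMap.comp_apply, ContinuousLinearMap.mul_apply'] at h
  exact (neg_eq_iff_eq_neg.2 h).symm

/-- `-i ∂/∂x₁ + B x₂ / 2` on Schwartz functions. -/
def magOp₁ (B : ℝ) : Module.End ℂ 𝓢(Plane, ℂ) :=
  (-Complex.I) • derivOp 0 + ((B / 2 : ℝ) : ℂ) • posOp 1

/-- `-i ∂/∂x₂ - B x₁ / 2` on Schwartz functions. -/
def magOp₂ (B : ℝ) : Module.End ℂ 𝓢(Plane, ℂ) :=
  (-Complex.I) • derivOp 1 - ((B / 2 : ℝ) : ℂ) • posOp 0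

lemma coe_magOp₁ (B : ℝ) (f : 𝓢(Plane, ℂ)) : ⇑(magOp₁ B f) = magMomentum₁ B f := by
  ext x
  change -Complex.I * derivOp 0 f x + ((B / 2 : ℝ) : ℂ) * posOp 1 f x = _
  rw [posOp_apply, derivOp_apply, magMomentum₁]
  push_cast
  ring

lemma coe_magOp₂ (B : ℝ) (f : 𝓢(Plane, ℂ)) : ⇑(magOp₂ B f) = magMomentum₂ B f := by
  ext x
  change -Complex.I * derivOp 1 f x - ((B / 2 : ℝ) : ℂ) * posOp 0 f x = _
  rw [posOp_apply, derivOp_apply, magMomentum₂]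
  push_cast
  ring

/-- `H_B + V` on Schwartz functions, `V` the oscillator potential. -/
def oscOp (B ω₁ ω₂ μ : ℝ) : Module.End ℂ 𝓢(Plane, ℂ) :=
  magOp₁ B * magOp₁ B + magOp₂ B * magOp₂ B + ((ω₁ ^ 2 : ℝ) : ℂ) • (posOp 0 * posOp 0)
    + ((ω₂ ^ 2 : ℝ) : ℂ) • (posOp 1 * posOp 1) - (μ : ℂ) • 1

lemma coe_oscOp (B ω₁ ω₂ μ : ℝ) (f : 𝓢(Plane, ℂ)) :
    ⇑(oscOp B ω₁ ω₂ μ f) = magSchrodingerExpr B (oscPotential ω₁ ω₂ μ) f := by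
  ext x
  change magOp₁ B (magOp₁ B f) x + magOp₂ B (magOp₂ B f) x
    + ((ω₁ ^ 2 : ℝ) : ℂ) * posOp 0 (posOp 0 f) x + ((ω₂ ^ 2 : ℝ) : ℂ) * posOp 1 (posOp 1 f) x
    - (μ : ℂ) * f x = _
  simp only [coe_magOp₁, coe_magOp₂, posOp_apply, magSchrodingerExpr, oscPotential]
  push_cast
  ring

lemma magOp₁_adj (B : ℝ) (f g : 𝓢(Plane, ℂ)) :
    ⟪schwartzToL2 (magOp₁ B f), schwartzToL2 g⟫_ℂ =
      ⟪schwartzToL2 f, schwartzToL2 (magOp₁ B g)⟫_ℂ := by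
  simp only [magOp₁, LinearMap.add_apply, LinearMap.smul_apply, map_add, map_smul, inner_add_left,
    inner_add_right, inner_smul_left, inner_smul_right, posOp_adj, derivOp_adj, Complex.conj_ofReal]
  simp

lemma magOp₂_adj (B : ℝ) (f g : 𝓢(Plane, ℂ)) :
    ⟪schwartzToL2 (magOp₂ B f), schwartzToL2 g⟫_ℂ =
      ⟪schwartzToL2 f, schwartzToL2 (magOp₂ B g)⟫_ℂ := by
  simp only [magOp₂, LinearMap.sub_apply, LinearMap.smul_apply, map_sub, map_smul, inner_sub_left,
    inner_sub_right, inner_smul_left, inner_smul_right, posOp_adj, derivOp_adj, Complex.conj_ofReal]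
  simp

lemma oscOp_adj (B ω₁ ω₂ μ : ℝ) (f g : 𝓢(Plane, ℂ)) :
    ⟪schwartzToL2 (oscOp B ω₁ ω₂ μ f), schwartzToL2 g⟫_ℂ =
      ⟪schwartzToL2 f, schwartzToL2 (oscOp B ω₁ ω₂ μ g)⟫_ℂ := by
  simp only [oscOp, LinearMap.sub_apply, LinearMap.add_apply, LinearMap.smul_apply, map_sub,
    map_add, map_smul, inner_sub_left, inner_sub_right, inner_add_left, inner_add_right,
    inner_smul_left, inner_smul_right, Module.End.mul_apply, Module.End.one_apply,
    posOp_adj, magOp₁_adj, magOp₂_adj, Complex.conj_ofReal]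

/-- The commutator `p q - q p`. -/
def opComm {V : Type*} [AddCommGroup V] [Module ℂ V] (p q : Module.End ℂ V) : Module.End ℂ V :=
  p * q - q * p

/-! ### Commutator calculus -/

section OpComm

variable {V : Type*} [AddCommGroup V] [Module ℂ V] (p q r : Module.End ℂ V) (c : ℂ)

lemma neg_opComm : -opComm q p = opComm p q := neg_sub _ _

lemma opComm_self : opComm p p = 0 := sub_self _

lemma opComm_add : opComm p (q + r) = opComm p q + opComm p r := by
  simp only [opComm, mul_add, add_mul]; abel

lemma opComm_sub : opComm p (q - r) = opComm p q - opComm p r := by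
  simp only [opComm, mul_sub, sub_mul]; abel

lemma opComm_smul : opComm p (c • q) = c • opComm p q := by
  simp only [opComm, mul_smul_comm, smul_mul_assoc, smul_sub]

lemma add_opComm : opComm (p + q) r = opComm p r + opComm q r := by
  simp only [opComm, mul_add, add_mul]; abel

lemma sub_opComm : opComm (p - q) r = opComm p r - opComm q r := by
  simp only [opComm, mul_sub, sub_mul]; abel

lemma smul_opComm : opComm (c • p) q = c • opComm p q := by
  simp only [opComm, mul_smul_comm, smul_mul_assoc, smul_sub]

end OpComm

lemma opComm_posOp_posOp (j k : Fin 2) : opComm (posOp j) (posOp k) = 0 := by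
  rw [opComm, posOp_mul_comm, sub_self]

lemma opComm_derivOp_derivOp (j k : Fin 2) : opComm (derivOp j) (derivOp k) = 0 := by
  rw [opComm, derivOp_mul_comm, sub_self]

lemma opComm_derivOp_posOp (j k : Fin 2) :
    opComm (derivOp j) (posOp k) = (if j = k then (1 : ℂ) else 0) • 1 := by
  rw [opComm, derivOp_mul_posOp, add_sub_cancel_left]

lemma opComm_posOp_derivOp (j k : Fin 2) :
    opComm (posOp j) (derivOp k) = (if j = k then (-1 : ℂ) else 0) • 1 := by
  rw [← neg_opComm, opComm_derivOp_posOp]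
  by_cases h : j = k
  · simp [h]
  · simp [h, Ne.symm h]

lemma opComm_posOp_magOp₁ (B : ℝ) (j : Fin 2) :
    opComm (posOp j) (magOp₁ B) = (if j = 0 then Complex.I else 0) • 1 := by
  rw [magOp₁, opComm_add, opComm_smul, opComm_smul, opComm_posOp_derivOp, opComm_posOp_posOp]
  split_ifs <;> simp

lemma opComm_posOp_magOp₂ (B : ℝ) (j : Fin 2) :
    opComm (posOp j) (magOp₂ B) = (if j = 1 then Complex.I else 0) • 1 := by
  rw [magOp₂, opComm_sub, opComm_smul, opComm_smul, opComm_posOp_derivOp, opComm_posOp_posOp]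
  split_ifs <;> simp

lemma opComm_magOp₁_magOp₂ (B : ℝ) : opComm (magOp₁ B) (magOp₂ B) = (Complex.I * B) • 1 := by
  simp only [magOp₁, magOp₂, opComm_sub, add_opComm, smul_opComm, opComm_smul, opComm_posOp_derivOp,
    opComm_derivOp_posOp, opComm_posOp_posOp, opComm_derivOp_derivOp, smul_smul]
  simp only [if_true, smul_zero, zero_add, add_zero, Complex.ofReal_div, Complex.ofReal_ofNat]
  module

/-- The operator `α₁ π₁ + α₂ π₂ + β₁ x₁ + β₂ x₂`. -/
def linOp (B : ℝ) (α₁ α₂ β₁ β₂ : ℂ) : Module.End ℂ 𝓢(Plane, ℂ) :=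
  α₁ • magOp₁ B + α₂ • magOp₂ B + β₁ • posOp 0 + β₂ • posOp 1

lemma opComm_magOp₂_magOp₁ (B : ℝ) : opComm (magOp₂ B) (magOp₁ B) = (-(Complex.I * B)) • 1 := by
  rw [← neg_opComm, opComm_magOp₁_magOp₂, neg_smul]

lemma opComm_magOp₁_posOp (B : ℝ) (j : Fin 2) :
    opComm (magOp₁ B) (posOp j) = (if j = 0 then -Complex.I else 0) • 1 := by
  rw [← neg_opComm, opComm_posOp_magOp₁]
  split_ifs <;> simp

lemma opComm_magOp₂_posOp (B : ℝ) (j : Fin 2) :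
    opComm (magOp₂ B) (posOp j) = (if j = 1 then -Complex.I else 0) • 1 := by
  rw [← neg_opComm, opComm_posOp_magOp₂]
  split_ifs <;> simp

lemma opComm_magOp₁_linOp (B : ℝ) (α₁ α₂ β₁ β₂ : ℂ) :
    opComm (magOp₁ B) (linOp B α₁ α₂ β₁ β₂) = (Complex.I * (B * α₂ - β₁)) • 1 := by
  simp only [linOp, opComm_add, opComm_smul, opComm_self, opComm_magOp₁_magOp₂, opComm_magOp₁_posOp, if_true,
    one_ne_zero, if_false]
  module

lemma opComm_magOp₂_linOp (B : ℝ) (α₁ α₂ β₁ β₂ : ℂ) :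
    opComm (magOp₂ B) (linOp B α₁ α₂ β₁ β₂) = (-Complex.I * (B * α₁ + β₂)) • 1 := by
  simp only [linOp, opComm_add, opComm_smul, opComm_self, opComm_magOp₂_magOp₁, opComm_magOp₂_posOp, if_true,
    zero_ne_one, if_false]
  module

lemma opComm_posOp_zero_linOp (B : ℝ) (α₁ α₂ β₁ β₂ : ℂ) :
    opComm (posOp 0) (linOp B α₁ α₂ β₁ β₂) = (Complex.I * α₁) • 1 := by
  simp only [linOp, opComm_add, opComm_smul, opComm_posOp_posOp, opComm_posOp_magOp₁, opComm_posOp_magOp₂, if_true,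
    zero_ne_one, if_false]
  module

lemma opComm_posOp_one_linOp (B : ℝ) (α₁ α₂ β₁ β₂ : ℂ) :
    opComm (posOp 1) (linOp B α₁ α₂ β₁ β₂) = (Complex.I * α₂) • 1 := by
  simp only [linOp, opComm_add, opComm_smul, opComm_posOp_posOp, opComm_posOp_magOp₁, opComm_posOp_magOp₂, if_true,
    one_ne_zero, if_false]
  module

lemma opComm_linOp_linOp (B : ℝ) (α₁ α₂ β₁ β₂ α₁' α₂' β₁' β₂' : ℂ) :
    opComm (linOp B α₁ α₂ β₁ β₂) (linOp B α₁' α₂' β₁' β₂') =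
      (Complex.I * (B * (α₁ * α₂' - α₂ * α₁') - α₁ * β₁' - α₂ * β₂' + β₁ * α₁' + β₂ * α₂')) • 1 := by
  rw [linOp, add_opComm, add_opComm, add_opComm, smul_opComm, smul_opComm, smul_opComm, smul_opComm,
    opComm_magOp₁_linOp, opComm_magOp₂_linOp, opComm_posOp_zero_linOp, opComm_posOp_one_linOp]
  module

lemma mul_self_opComm {p q : Module.End ℂ 𝓢(Plane, ℂ)} {s : ℂ} (h : opComm p q = s • 1) :
    opComm (p * p) q = (2 * s) • p := by
  have h1 : opComm (p * p) q = p * opComm p q + opComm p q * p := by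
    simp only [opComm]; noncomm_ring
  rw [h1, h, mul_smul_comm, smul_mul_assoc, mul_one, one_mul]
  module

/-- Commuting a quadratic operator with a linear one yields a linear one, so the search for ladder
operators is a 4 by 4 eigenvalue problem for the coefficients. -/
lemma opComm_oscOp_linOp (B ω₁ ω₂ μ : ℝ) (α₁ α₂ β₁ β₂ : ℂ) :
    opComm (oscOp B ω₁ ω₂ μ) (linOp B α₁ α₂ β₁ β₂) =
      linOp B (2 * Complex.I * (B * α₂ - β₁)) (-2 * Complex.I * (B * α₁ + β₂))
        (2 * Complex.I * ω₁ ^ 2 * α₁) (2 * Complex.I * ω₂ ^ 2 * α₂) := by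
  have h1 : opComm (1 : Module.End ℂ 𝓢(Plane, ℂ)) (linOp B α₁ α₂ β₁ β₂) = 0 := by
    rw [opComm]; simp
  rw [oscOp, sub_opComm, add_opComm, add_opComm, add_opComm, smul_opComm,
    smul_opComm, smul_opComm, h1,
    mul_self_opComm (opComm_magOp₁_linOp B α₁ α₂ β₁ β₂),
    mul_self_opComm (opComm_magOp₂_linOp B α₁ α₂ β₁ β₂),
    mul_self_opComm (opComm_posOp_zero_linOp B α₁ α₂ β₁ β₂),
    mul_self_opComm (opComm_posOp_one_linOp B α₁ α₂ β₁ β₂), linOp]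
  push_cast
  module

lemma linOp_adj (B : ℝ) (α₁ α₂ β₁ β₂ : ℂ) (f g : 𝓢(Plane, ℂ)) :
    ⟪schwartzToL2 (linOp B α₁ α₂ β₁ β₂ f), schwartzToL2 g⟫_ℂ =
      ⟪schwartzToL2 f,
        schwartzToL2 (linOp B (conj α₁) (conj α₂) (conj β₁) (conj β₂) g)⟫_ℂ := by
  simp only [linOp, LinearMap.add_apply, LinearMap.smul_apply, map_add, map_smul, inner_add_left,
    inner_add_right, inner_smul_left, inner_smul_right, posOp_adj, magOp₁_adj, magOp₂_adj]

end SchwartzOps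

end

noncomputable section

/-! ### Gaussian Schwartz functions -/

section Gaussian

lemma iteratedDeriv_cexp_mul_ofReal (c : ℂ) (n : ℕ) :
    iteratedDeriv n (fun t : ℝ => Complex.exp (c * t)) =
      fun t : ℝ => c ^ n * Complex.exp (c * t) := by
  induction n with
  | zero => simp
  | succ n ih =>
    rw [iteratedDeriv_succ, ih]
    ext t
    have h1 : HasDerivAt (fun t : ℝ => c * (t : ℂ)) c t := by
      simpa using (Complex.ofRealCLM.hasDerivAt (x := t)).const_mul c
    rw [(h1.cexp.const_mul (c ^ n)).deriv]
    ring

lemma contDiff_cexp_mul_ofReal (c : ℂ) : ContDiff ℝ ∞ (fun t : ℝ => Complex.exp (c * t)) :=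
  (contDiff_const.mul Complex.ofRealCLM.contDiff).cexp

/-- With `‖c‖ = 1` every derivative of `t ↦ exp (c t)` has the modulus of the function itself. The
case `c = I` handles the phase of the Gaussian, `c = -1` its decay. -/
lemma exists_norm_iteratedFDeriv_cexp_le {E : Type*} [NormedAddCommGroup E] [NormedSpace ℝ E]
    {q : E → ℝ} (hq : q.HasTemperateGrowth) {c : ℂ} (hc : ‖c‖ = 1) (n : ℕ) :
    ∃ (k : ℕ) (C : ℝ), 0 ≤ C ∧ ∀ x, ‖iteratedFDeriv ℝ n (fun x => Complex.exp (c * q x)) x‖ ≤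
      C * (1 + ‖x‖) ^ k * ‖Complex.exp (c * q x)‖ := by
  obtain ⟨k, C, hC, h⟩ := hq.norm_iteratedFDeriv_le_uniform n
  refine ⟨k * n, n.factorial * (1 + C) ^ n, by positivity, fun x => ?_⟩
  have h1 : ∀ i, i ≤ n → ‖iteratedFDeriv ℝ i (fun t : ℝ => Complex.exp (c * t)) (q x)‖ ≤
      ‖Complex.exp (c * q x)‖ := by
    intro i _
    rw [norm_iteratedFDeriv_eq_norm_iteratedDeriv, iteratedDeriv_cexp_mul_ofReal, norm_mul,
      norm_pow, hc, one_pow, one_mul]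
  -- Using `1 + C` instead of `C` makes the base at least one, so that it is bounded by its `i`-th
  -- power, the form needed for the derivative bound of a composition.
  have h2 : ∀ i, 1 ≤ i → i ≤ n → ‖iteratedFDeriv ℝ i q x‖ ≤ ((1 + C) * (1 + ‖x‖) ^ k) ^ i := by
    intro i hi hi'
    calc _ ≤ C * (1 + ‖x‖) ^ k := h i hi' x
      _ ≤ (1 + C) * (1 + ‖x‖) ^ k := by gcongr; simp
      _ ≤ _ := by
        apply le_self_pow₀ (one_le_mul_of_one_le_of_one_le (by simp [hC]) (by simp [one_le_pow₀]))
        lia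
  have h3 := norm_iteratedFDeriv_comp_le (contDiff_cexp_mul_ofReal c) hq.1
    (by exact_mod_cast le_top) x h1 h2
  refine h3.trans (le_of_eq ?_)
  rw [mul_pow, ← pow_mul]
  ring

lemma hasTemperateGrowth_cexp_I_mul {E : Type*} [NormedAddCommGroup E] [NormedSpace ℝ E]
    {q : E → ℝ} (hq : q.HasTemperateGrowth) :
    (fun x => Complex.exp (Complex.I * q x)).HasTemperateGrowth := by
  refine ⟨(contDiff_cexp_mul_ofReal Complex.I).comp hq.1, fun n => ?_⟩
  obtain ⟨k, C, -, h⟩ := exists_norm_iteratedFDeriv_cexp_le hq Complex.norm_I n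
  refine ⟨k, C, fun x => (h x).trans (le_of_eq ?_)⟩
  rw [mul_comm Complex.I, Complex.norm_exp_ofReal_mul_I, mul_one]

/-- Bound `1 + r` by `exp r` and complete the square in `m r - b r²`. -/
lemma one_add_pow_mul_exp_neg_sq_le {b : ℝ} (hb : 0 < b) (m : ℕ) {r : ℝ} (hr : 0 ≤ r) :
    (1 + r) ^ m * Real.exp (-(b * r ^ 2)) ≤ Real.exp (m ^ 2 / (4 * b)) := by
  have h1 : (1 + r) ^ m ≤ Real.exp (m * r) := by
    rw [Real.exp_nat_mul]
    gcongr
    linarith [Real.add_one_le_exp r]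
  calc _ ≤ Real.exp (m * r) * Real.exp (-(b * r ^ 2)) := by gcongr
    _ = Real.exp (m * r + -(b * r ^ 2)) := (Real.exp_add _ _).symm
    _ ≤ _ := by
      rw [Real.exp_le_exp, le_div_iff₀ (by positivity)]
      nlinarith [sq_nonneg (m - 2 * b * r)]

/-- The Schwartz function `exp (-q)`, for `q` of temperate growth and at least quadratic growth. -/
def expNegSchwartz {E : Type*} [NormedAddCommGroup E] [NormedSpace ℝ E] {q : E → ℝ}
    (hq : q.HasTemperateGrowth) {b : ℝ} (hb : 0 < b) (hqb : ∀ x, b * ‖x‖ ^ 2 ≤ q x) :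
    𝓢(E, ℂ) where
  toFun x := Complex.exp ((-1) * q x)
  smooth' := (contDiff_cexp_mul_ofReal (-1)).comp hq.1
  decay' := by
    intro k n
    obtain ⟨l, C, hC, h⟩ := exists_norm_iteratedFDeriv_cexp_le hq (c := -1) (by simp) n
    refine ⟨C * Real.exp ((k + l : ℕ) ^ 2 / (4 * b)), fun x => ?_⟩
    have h0 : ‖Complex.exp ((-1) * q x)‖ ≤ Real.exp (-(b * ‖x‖ ^ 2)) := by
      rw [Complex.norm_exp]
      simpa using hqb x
    calc _ ≤ (1 + ‖x‖) ^ k * (C * (1 + ‖x‖) ^ l * Real.exp (-(b * ‖x‖ ^ 2))) := by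
          refine mul_le_mul ?_ ((h x).trans (by gcongr)) (norm_nonneg _) (by positivity)
          gcongr
          simp
      _ = C * ((1 + ‖x‖) ^ (k + l) * Real.exp (-(b * ‖x‖ ^ 2))) := by rw [pow_add]; ring
      _ ≤ _ := by
          gcongr
          exact one_add_pow_mul_exp_neg_sq_le hb _ (norm_nonneg _)

/-- The quadratic form `(a x₁² + c x₂²) / 2`. -/
def diagQuad (a c : ℝ) (x : Plane) : ℝ := (a * x 0 ^ 2 + c * x 1 ^ 2) / 2

lemma hasTemperateGrowth_apply (j : Fin 2) : (fun x : Plane => x j).HasTemperateGrowth :=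
  (EuclideanSpace.proj (𝕜 := ℝ) j : Plane →L[ℝ] ℝ).hasTemperateGrowth

lemma hasTemperateGrowth_diagQuad (a c : ℝ) : (diagQuad a c).HasTemperateGrowth := by
  have h0 := hasTemperateGrowth_apply 0
  have h1 := hasTemperateGrowth_apply 1
  have : diagQuad a c = fun x => (a / 2) * x 0 ^ 2 + (c / 2) * x 1 ^ 2 := by
    ext x; simp only [diagQuad]; ring
  rw [this]
  exact (((Function.HasTemperateGrowth.const (a / 2)).mul (h0.pow 2))).add
    (((Function.HasTemperateGrowth.const (c / 2)).mul (h1.pow 2)))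

lemma hasTemperateGrowth_mul_coord (γ : ℝ) :
    (fun x : Plane => γ * (x 0 * x 1)).HasTemperateGrowth :=
  (Function.HasTemperateGrowth.const γ).mul
    ((hasTemperateGrowth_apply 0).mul (hasTemperateGrowth_apply 1))

lemma norm_sq_plane (x : Plane) : ‖x‖ ^ 2 = x 0 ^ 2 + x 1 ^ 2 := by
  rw [EuclideanSpace.norm_sq_eq]; simp

lemma diagQuad_ge {a c : ℝ} (x : Plane) : min a c / 2 * ‖x‖ ^ 2 ≤ diagQuad a c x := by
  rw [norm_sq_plane, diagQuad]
  have h1 := mul_le_mul_of_nonneg_right (min_le_left a c) (sq_nonneg (x 0))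
  have h2 := mul_le_mul_of_nonneg_right (min_le_right a c) (sq_nonneg (x 1))
  linarith

/-- The Schwartz function `exp (-(a x₁² + c x₂²) / 2 + i γ x₁ x₂)`. -/
def gaussianState {a c : ℝ} (ha : 0 < a) (hc : 0 < c) (γ : ℝ) : 𝓢(Plane, ℂ) :=
  SchwartzMap.smulLeftCLM ℂ (fun x : Plane => Complex.exp (Complex.I * (γ * (x 0 * x 1) : ℝ)))
    (expNegSchwartz (hasTemperateGrowth_diagQuad a c) (half_pos (lt_min ha hc)) diagQuad_ge)

lemma gaussianState_apply {a c : ℝ} (ha : 0 < a) (hc : 0 < c) (γ : ℝ) (x : Plane) :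
    gaussianState ha hc γ x =
      Complex.exp (Complex.I * (γ * (x 0 * x 1)) - (a * x 0 ^ 2 + c * x 1 ^ 2) / 2) := by
  rw [gaussianState, SchwartzMap.smulLeftCLM_apply_apply
    (hasTemperateGrowth_cexp_I_mul (hasTemperateGrowth_mul_coord γ))]
  change Complex.exp _ * Complex.exp _ = _
  rw [← Complex.exp_add, diagQuad]
  congr 1
  push_cast
  ring

lemma norm_gaussianState_le {a c : ℝ} (ha : 0 < a) (hc : 0 < c) (γ : ℝ) (x : Plane) :
    ‖gaussianState ha hc γ x‖ ≤ Real.exp (-(min a c / 2 * ‖x‖ ^ 2)) := by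
  have h := diagQuad_ge (a := a) (c := c) x
  rw [gaussianState_apply, Complex.norm_exp, Real.exp_le_exp]
  have : (Complex.I * ((γ : ℂ) * (x 0 * x 1)) - ((a : ℂ) * x 0 ^ 2 + c * x 1 ^ 2) / 2) =
      ((-diagQuad a c x : ℝ) : ℂ) + ((γ * (x 0 * x 1) : ℝ) : ℂ) * Complex.I := by
    rw [diagQuad]; push_cast; ring
  rw [this, Complex.add_re, Complex.ofReal_re, Complex.re_ofReal_mul, Complex.I_re, mul_zero,
    add_zero]
  linarith

lemma partialDeriv_gaussianState {a c : ℝ} (ha : 0 < a) (hc : 0 < c) (γ : ℝ) (j : Fin 2)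
    (x : Plane) : partialDeriv j (gaussianState ha hc γ) x =
      (if j = 0 then Complex.I * γ * x 1 - a * x 0 else Complex.I * γ * x 0 - c * x 1) *
        gaussianState ha hc γ x := by
  have hx : ∀ k : Fin 2, HasFDerivAt (fun x : Plane => ((x k : ℝ) : ℂ))
      (Complex.ofRealCLM.comp (EuclideanSpace.proj (𝕜 := ℝ) k)) x := fun k =>
    (Complex.ofRealCLM.comp (EuclideanSpace.proj (𝕜 := ℝ) k)).hasFDerivAt
  have h1 := ((((hx 0).mul (hx 1)).const_mul (γ : ℂ)).const_mul Complex.I).sub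
    ((((((hx 0).pow 2).const_mul (a : ℂ)).add (((hx 1).pow 2).const_mul (c : ℂ)))).mul_const (2⁻¹ : ℂ))
  have h2 : HasFDerivAt (gaussianState ha hc γ) _ x :=
    h1.cexp.congr_of_eventuallyEq (Filter.Eventually.of_forall fun y => by
      rw [gaussianState_apply, div_eq_mul_inv]; rfl)
  rw [partialDeriv, h2.fderiv, gaussianState_apply]
  fin_cases j
  · simp; ring_nf
  · simp; ring_nf

end Gaussian

end

noncomputable section

/-! ### Density of polynomials times a Gaussian -/

section Density

open scoped FourierTransform ComplexConjugate

/-- Each test function is the Fourier transform of a Schwartz function, and the transform can be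
moved onto `g`; so `g` integrates to zero against all test functions. -/
lemma ae_eq_zero_of_fourier_eq_zero {g : Plane → ℂ} (hg : Integrable g) (h : 𝓕 g = 0) :
    ∀ᵐ x, g x = 0 := by
  refine ae_eq_zero_of_integral_contDiff_smul_eq_zero hg.locallyIntegrable fun u hu hc => ?_
  have hu' : ContDiff ℝ ∞ (fun x => (u x : ℂ)) := Complex.ofRealCLM.contDiff.comp hu
  have hc' : HasCompactSupport (fun x => (u x : ℂ)) := hc.comp_left Complex.ofReal_zero
  set ψ : 𝓢(Plane, ℂ) := hc'.toSchwartzMap hu'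
  have h1 : 𝓕 (𝓕⁻ ψ : 𝓢(Plane, ℂ)) = ψ := FourierTransform.fourier_fourierInv_eq ψ
  have h2 := VectorFourier.integral_fourierIntegral_smul_eq_flip (L := innerₗ Plane)
    (μ := volume) (ν := volume) Real.continuous_fourierChar continuous_inner
    (𝓕⁻ ψ : 𝓢(Plane, ℂ)).integrable hg
  rw [flip_innerₗ] at h2
  have h3 : ∫ x, (ψ x) • g x = 0 := by
    rw [← h1]
    refine h2.trans ?_
    have : VectorFourier.fourierIntegral Real.fourierChar volume (innerₗ Plane) g = 0 := h
    rw [this]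
    simp
  simp_rw [Complex.real_smul]
  exact h3

/-- Half of the Gaussian exponent absorbs `exp (r ‖x‖)`; the other half is square integrable and is
paired with `f`. -/
lemma integrable_exp_mul_of_dominated {g : Plane → ℂ} (f : L2Plane) {b : ℝ} (hb : 0 < b)
    (hg : Continuous g) (hgb : ∀ x, ‖g x‖ ≤ Real.exp (-(b * ‖x‖ ^ 2))) (r : ℝ) :
    Integrable fun x => Real.exp (r * ‖x‖) * ‖g x * f x‖ := by
  have hq : (fun x : Plane => b / 2 * ‖x‖ ^ 2).HasTemperateGrowth :=
    (Function.HasTemperateGrowth.const (b / 2)).mul (Function.hasTemperateGrowth_norm_sq Plane)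
  have h1 : MemLp (expNegSchwartz hq (half_pos hb) fun _ => le_rfl) 2 (volume : Measure Plane) :=
    SchwartzMap.memLp _ 2 volume
  have h2 : MemLp (fun x => Real.exp (r * ‖x‖) * ‖g x‖) 2 (volume : Measure Plane) := by
    refine h1.of_le_mul (c := Real.exp (r ^ 2 / (2 * b))) ?_ (Filter.Eventually.of_forall fun x => ?_)
    · exact Continuous.aestronglyMeasurable (by fun_prop)
    · have h3 : ‖(expNegSchwartz hq (half_pos hb) fun _ => le_rfl) x‖ =
          Real.exp (-(b / 2 * ‖x‖ ^ 2)) := by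
        change ‖Complex.exp _‖ = _
        rw [Complex.norm_exp]
        congr 1
        rw [← Complex.ofReal_one, ← Complex.ofReal_neg, ← Complex.ofReal_mul, Complex.ofReal_re]
        ring
      rw [h3, ← Real.exp_add, norm_mul, norm_norm, Real.norm_of_nonneg (Real.exp_nonneg _)]
      calc _ ≤ Real.exp (r * ‖x‖) * Real.exp (-(b * ‖x‖ ^ 2)) := by gcongr; exact hgb x
        _ = Real.exp (r * ‖x‖ + -(b * ‖x‖ ^ 2)) := (Real.exp_add _ _).symm
        _ ≤ _ := by
          rw [Real.exp_le_exp]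
          have : r * ‖x‖ ≤ r ^ 2 / (2 * b) + b / 2 * ‖x‖ ^ 2 := by
            have h4 : r ^ 2 / (2 * b) + b / 2 * ‖x‖ ^ 2 - r * ‖x‖ = (r - b * ‖x‖) ^ 2 / (2 * b) := by
              field_simp
              ring
            have : 0 ≤ (r - b * ‖x‖) ^ 2 / (2 * b) := by positivity
            linarith
          linarith
  have h5 := h2.integrable_mul (Lp.memLp f).norm
  refine h5.congr (Filter.Eventually.of_forall fun x => ?_)
  simp [mul_assoc]

/-- Exponential integrability allows the Fourier kernel to be expanded in its power series under the
integral; every term is a vanishing moment, so the Fourier transform of `g` is zero. -/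
lemma ae_eq_zero_of_moments_eq_zero {g : Plane → ℂ} (hg : AEStronglyMeasurable g volume)
    (hgint : ∀ r : ℝ, Integrable fun x => Real.exp (r * ‖x‖) * ‖g x‖)
    (h : ∀ (ξ : Plane) (n : ℕ), ∫ x, ((⟪ξ, x⟫_ℝ : ℝ) : ℂ) ^ n * g x = 0) : ∀ᵐ x, g x = 0 := by
  have hgi : Integrable g := by
    have := hgint 0
    simp only [zero_mul, Real.exp_zero, one_mul] at this
    exact (integrable_norm_iff hg).1 this
  refine ae_eq_zero_of_fourier_eq_zero hgi ?_
  ext w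
  rw [Real.fourier_eq']
  have hsum : HasSum (fun n : ℕ => ∫ x, (((-2 * Real.pi : ℝ) : ℂ) * Complex.I) ^ n / n.factorial *
      (((⟪w, x⟫_ℝ : ℝ) : ℂ) ^ n * g x)) (∫ x, Complex.exp (((-2 * Real.pi * ⟪x, w⟫_ℝ : ℝ) : ℂ) *
        Complex.I) • g x) := by
    refine hasSum_integral_of_dominated_convergence
      (fun n x => (2 * Real.pi * ‖w‖ * ‖x‖) ^ n / n.factorial * ‖g x‖) ?_ ?_ ?_ ?_ ?_
    · intro n
      refine (AEStronglyMeasurable.mul ?_ hg).const_mul _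
      exact Continuous.aestronglyMeasurable (by fun_prop)
    · refine fun n => Filter.Eventually.of_forall fun x => ?_
      rw [norm_mul, norm_mul, norm_div, norm_pow, norm_pow, norm_mul, Complex.norm_real,
        Complex.norm_I, Complex.norm_natCast, Complex.norm_real, ← mul_assoc]
      refine mul_le_mul_of_nonneg_right ?_ (norm_nonneg _)
      rw [mul_one, div_mul_eq_mul_div, ← mul_pow]
      refine div_le_div_of_nonneg_right ?_ (by positivity)
      refine pow_le_pow_left₀ (by positivity) ?_ n
      have h1 : ‖(-2 * Real.pi : ℝ)‖ = 2 * Real.pi := by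
        rw [norm_mul, Real.norm_of_nonneg Real.pi_pos.le]; norm_num
      rw [h1, mul_assoc _ ‖w‖]
      exact mul_le_mul_of_nonneg_left (norm_inner_le_norm w x) (by positivity)
    · exact Filter.Eventually.of_forall fun x =>
        (Real.summable_pow_div_factorial _).mul_right _
    · refine (hgint (2 * Real.pi * ‖w‖)).congr (Filter.Eventually.of_forall fun x => ?_)
      simp only
      rw [tsum_mul_right, Real.exp_eq_exp_ℝ, NormedSpace.exp_eq_tsum_div]
    · refine Filter.Eventually.of_forall fun x => ?_
      have h1 := (NormedSpace.expSeries_div_hasSum_exp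
        (((-2 * Real.pi * ⟪x, w⟫_ℝ : ℝ) : ℂ) * Complex.I)).mul_right (g x)
      rw [← Complex.exp_eq_exp_ℂ] at h1
      refine h1.congr_fun ?_
      intro n
      rw [real_inner_comm]
      push_cast
      ring
  have hz : (fun n : ℕ => ∫ x, (((-2 * Real.pi : ℝ) : ℂ) * Complex.I) ^ n / n.factorial *
      (((⟪w, x⟫_ℝ : ℝ) : ℂ) ^ n * g x)) = fun _ => 0 := by
    ext n
    rw [integral_const_mul, h, mul_zero]
  rw [hz] at hsum
  exact hsum.unique hasSum_zero

/-- A subspace of Schwartz functions that is invariant under multiplication by the coordinates and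
contains a Gaussian has trivial orthogonal complement. -/
theorem eq_zero_of_orthogonal {a c : ℝ} (ha : 0 < a) (hc : 0 < c) (γ : ℝ)
    (W : Submodule ℂ 𝓢(Plane, ℂ)) (h0 : gaussianState ha hc γ ∈ W)
    (hW : ∀ j, ∀ u ∈ W, posOp j u ∈ W) (f : L2Plane)
    (hf : ∀ u ∈ W, ⟪schwartzToL2 u, f⟫_ℂ = 0) : f = 0 := by
  set g := gaussianState ha hc γ with hg
  have hb : 0 < min a c / 2 := half_pos (lt_min ha hc)
  have hcont : Continuous fun x => conj (g x) := Complex.continuous_conj.comp g.continuous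
  have hmom : ∀ (ξ : Plane) (n : ℕ), ∫ x, ((⟪ξ, x⟫_ℝ : ℝ) : ℂ) ^ n * (conj (g x) * f x) = 0 := by
    intro ξ n
    -- Multiplication by `⟪ξ, x⟫`; its powers applied to the Gaussian stay in `W` and produce the
    -- moments.
    set q : Module.End ℂ 𝓢(Plane, ℂ) := (ξ 0 : ℂ) • posOp 0 + (ξ 1 : ℂ) • posOp 1 with hq
    have hqx : ∀ u x, q u x = ((⟪ξ, x⟫_ℝ : ℝ) : ℂ) * u x := by
      intro u x
      change (ξ 0 : ℂ) * posOp 0 u x + (ξ 1 : ℂ) * posOp 1 u x = _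
      rw [posOp_apply, posOp_apply, PiLp.inner_apply]
      simp only [Fin.sum_univ_two, RCLike.inner_apply, conj_trivial]
      push_cast
      ring
    have hmem : ∀ n : ℕ, (q ^ n) g ∈ W ∧ ∀ x, (q ^ n) g x = ((⟪ξ, x⟫_ℝ : ℝ) : ℂ) ^ n * g x := by
      intro n
      induction n with
      | zero => exact ⟨by simpa using h0, fun x => by simp⟩
      | succ n ih =>
        rw [pow_succ', Module.End.mul_apply]
        refine ⟨?_, fun x => ?_⟩
        · rw [hq, LinearMap.add_apply, LinearMap.smul_apply, LinearMap.smul_apply]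
          exact W.add_mem (W.smul_mem _ (hW 0 _ ih.1)) (W.smul_mem _ (hW 1 _ ih.1))
        · rw [hqx, ih.2]; ring
    have h1 := hf _ (hmem n).1
    rw [L2.inner_def] at h1
    rw [← h1]
    refine integral_congr_ae ?_
    filter_upwards [coeFn_schwartzToL2 ((q ^ n) g)] with x hx
    rw [hx, (hmem n).2, RCLike.inner_apply, map_mul, map_pow, Complex.conj_ofReal]
    ring
  have hz := ae_eq_zero_of_moments_eq_zero
    (hcont.aestronglyMeasurable.mul (Lp.aestronglyMeasurable f))
    (fun r => integrable_exp_mul_of_dominated f hb hcont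
      (fun x => by rw [RCLike.norm_conj]; exact norm_gaussianState_le ha hc γ x) r) hmom
  rw [Lp.eq_zero_iff_ae_eq_zero]
  filter_upwards [hz] with x hx
  -- A Gaussian has no zeros, so it can be divided out.
  have hne : conj (g x) ≠ 0 := by
    rw [hg, gaussianState_apply]
    simp
  simpa [hne] using hx

end Density

end

noncomputable section

/-! ### Diagonalization of the magnetic oscillator -/

section Diagonalization

open scoped ComplexConjugate

/-- `ν`, `ν'` are the two normal frequencies of the magnetic oscillator. -/
structure IsFreqPair (B ω₁ ω₂ ν ν' : ℝ) : Prop where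
  hB : 0 < B
  hω₁ : 0 < ω₁
  hω₂ : 0 < ω₂
  hν : 0 < ν
  hν' : 0 < ν'
  mul_eq : ν * ν' = ω₁ * ω₂
  sq_add : ν ^ 2 + ν' ^ 2 = ω₁ ^ 2 + ω₂ ^ 2 + B ^ 2
  ne : ν ≠ ν'

variable {B ω₁ ω₂ ν ν' : ℝ}

namespace IsFreqPair

lemma symm (h : IsFreqPair B ω₁ ω₂ ν ν') : IsFreqPair B ω₁ ω₂ ν' ν where
  hB := h.hB
  hω₁ := h.hω₁
  hω₂ := h.hω₂
  hν := h.hν'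
  hν' := h.hν
  mul_eq := by rw [mul_comm, h.mul_eq]
  sq_add := by rw [add_comm, h.sq_add]
  ne := h.ne.symm

/-- This is the characteristic equation of the normal modes: `ν²` and `ν'²` are the roots of `(z -
ω₁²)(z - ω₂²) - B² z`. -/
lemma quartic (h : IsFreqPair B ω₁ ω₂ ν ν') :
    (ν ^ 2 - ω₁ ^ 2) * (ν ^ 2 - ω₂ ^ 2) = B ^ 2 * ν ^ 2 := by
  linear_combination ν ^ 2 * h.sq_add - (ν * ν' + ω₁ * ω₂) * h.mul_eq

/-- The characteristic polynomial evaluated at `z = ω₁²`. This is the relation that makes ladder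
operators of different frequencies commute. -/
lemma mul_shift (h : IsFreqPair B ω₁ ω₂ ν ν') :
    (ν ^ 2 - ω₁ ^ 2) * (ν' ^ 2 - ω₁ ^ 2) + B ^ 2 * ω₁ ^ 2 = 0 := by
  linear_combination (ν * ν' + ω₁ * ω₂) * h.mul_eq - ω₁ ^ 2 * h.sq_add

lemma sq_ne (h : IsFreqPair B ω₁ ω₂ ν ν') : ν ^ 2 - ν' ^ 2 ≠ 0 := by
  rw [sq_sub_sq]
  exact mul_ne_zero (add_pos h.hν h.hν').ne' (sub_ne_zero.2 h.ne)

lemma sum_sq (h : IsFreqPair B ω₁ ω₂ ν ν') : (ν + ν') ^ 2 = (ω₁ + ω₂) ^ 2 + B ^ 2 := by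
  linear_combination h.sq_add + 2 * h.mul_eq

end IsFreqPair

/-- The annihilation operator of frequency `ν` (not normalized). -/
def lowerOp (B ω₁ ν : ℝ) : Module.End ℂ 𝓢(Plane, ℂ) :=
  linOp B (B * ν) (Complex.I * (ν ^ 2 - ω₁ ^ 2)) (-(Complex.I * (ω₁ ^ 2 * B)))
    (ν * (ν ^ 2 - ω₁ ^ 2) - B ^ 2 * ν)

/-- The creation operator of frequency `ν` (not normalized). -/
def raiseOp (B ω₁ ν : ℝ) : Module.End ℂ 𝓢(Plane, ℂ) :=
  linOp B (B * ν) (-(Complex.I * (ν ^ 2 - ω₁ ^ 2))) (Complex.I * (ω₁ ^ 2 * B))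
    (ν * (ν ^ 2 - ω₁ ^ 2) - B ^ 2 * ν)

/-- The value of the commutator of `lowerOp` and `raiseOp`. -/
def ladderConst (B ω₁ ν : ℝ) : ℝ :=
  2 * B ^ 2 * ν ^ 3 + 2 * ((ν ^ 2 - ω₁ ^ 2) * (ν * (ν ^ 2 - ω₁ ^ 2) - B ^ 2 * ν))

lemma IsFreqPair.ladderConst_pos (h : IsFreqPair B ω₁ ω₂ ν ν') : 0 < ladderConst B ω₁ ν := by
  -- The sign of `ν² - ω₁²` depends on the mode; after multiplication by `ν` the characteristic
  -- equation turns the second summand into a square.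
  have h1 : ν * ((ν ^ 2 - ω₁ ^ 2) * (ν * (ν ^ 2 - ω₁ ^ 2) - B ^ 2 * ν)) =
      ω₂ ^ 2 * (ν ^ 2 - ω₁ ^ 2) ^ 2 := by
    linear_combination (ν ^ 2 - ω₁ ^ 2) * h.quartic
  have h2 : 0 ≤ (ν ^ 2 - ω₁ ^ 2) * (ν * (ν ^ 2 - ω₁ ^ 2) - B ^ 2 * ν) := by
    refine nonneg_of_mul_nonneg_right ?_ h.hν
    rw [h1]
    positivity
  have h3 : 0 < 2 * B ^ 2 * ν ^ 3 := by
    have := h.hB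
    have := h.hν
    positivity
  rw [ladderConst]
  linarith

lemma smul_linOp (c α₁ α₂ β₁ β₂ : ℂ) :
    c • linOp B α₁ α₂ β₁ β₂ = linOp B (c * α₁) (c * α₂) (c * β₁) (c * β₂) := by
  simp only [linOp]
  module

lemma mul_eq_of_opComm {V : Type*} [AddCommGroup V] [Module ℂ V] {p q r : Module.End ℂ V}
    (h : opComm p q = r) : p * q = q * p + r := by
  rw [← h, opComm]; abel

lemma lowerOp_mul_raiseOp (B ω₁ ν : ℝ) : lowerOp B ω₁ ν * raiseOp B ω₁ ν =
    raiseOp B ω₁ ν * lowerOp B ω₁ ν + (ladderConst B ω₁ ν : ℂ) • 1 := by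
  refine mul_eq_of_opComm ?_
  rw [lowerOp, raiseOp, opComm_linOp_linOp, ladderConst]
  congr 1
  push_cast
  linear_combination (-2 * (B : ℂ) ^ 2 * ν * ω₁ ^ 2 - 2 * B ^ 2 * ν * (ν ^ 2 - ω₁ ^ 2)
    - 2 * (ν ^ 2 - ω₁ ^ 2) * (ν * (ν ^ 2 - ω₁ ^ 2) - B ^ 2 * ν)) * Complex.I_sq

lemma commute_of_opComm {V : Type*} [AddCommGroup V] [Module ℂ V] {p q : Module.End ℂ V}
    (h : opComm p q = 0) : Commute p q := sub_eq_zero.1 h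

namespace IsFreqPair

lemma mul_shift_complex (h : IsFreqPair B ω₁ ω₂ ν ν') :
    ((ν : ℂ) ^ 2 - ω₁ ^ 2) * (ν' ^ 2 - ω₁ ^ 2) + B ^ 2 * ω₁ ^ 2 = 0 := by
  exact_mod_cast h.mul_shift

lemma commute_raiseOp (h : IsFreqPair B ω₁ ω₂ ν ν') :
    Commute (raiseOp B ω₁ ν) (raiseOp B ω₁ ν') := by
  refine commute_of_opComm ?_
  rw [raiseOp, raiseOp, opComm_linOp_linOp]
  convert zero_smul ℂ _ using 2
  linear_combination (-Complex.I ^ 2 * (ν - ν')) * h.mul_shift_complex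

lemma commute_lowerOp_raiseOp (h : IsFreqPair B ω₁ ω₂ ν ν') :
    Commute (lowerOp B ω₁ ν) (raiseOp B ω₁ ν') := by
  refine commute_of_opComm ?_
  rw [lowerOp, raiseOp, opComm_linOp_linOp]
  convert zero_smul ℂ _ using 2
  linear_combination (-Complex.I ^ 2 * (ν + ν')) * h.mul_shift_complex

/-- The coefficients of `raiseOp` form an eigenvector of the commutator map for the eigenvalue `2ν`.
Apart from `I² = -1`, only the last component needs the characteristic equation. -/
lemma oscOp_mul_raiseOp (h : IsFreqPair B ω₁ ω₂ ν ν') (μ : ℝ) :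
    oscOp B ω₁ ω₂ μ * raiseOp B ω₁ ν =
      raiseOp B ω₁ ν * oscOp B ω₁ ω₂ μ + (2 * ν : ℂ) • raiseOp B ω₁ ν := by
  refine mul_eq_of_opComm ?_
  have hq : ((ν : ℂ) ^ 2 - ω₁ ^ 2) * (ν ^ 2 - ω₂ ^ 2) = B ^ 2 * ν ^ 2 := by
    exact_mod_cast h.quartic
  rw [raiseOp, opComm_oscOp_linOp, smul_linOp]
  congr 1
  · linear_combination (-2 * (B : ℂ) * ν ^ 2) * Complex.I_sq
  · ring
  · ring
  · linear_combination (-2 * (ω₂ : ℂ) ^ 2 * (ν ^ 2 - ω₁ ^ 2)) * Complex.I_sq - 2 * hq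

end IsFreqPair

lemma adj_lowerOp (B ω₁ ν : ℝ) (f g : 𝓢(Plane, ℂ)) :
    ⟪schwartzToL2 (lowerOp B ω₁ ν f), schwartzToL2 g⟫_ℂ =
      ⟪schwartzToL2 f, schwartzToL2 (raiseOp B ω₁ ν g)⟫_ℂ := by
  rw [lowerOp, linOp_adj, raiseOp]
  simp

/-! ### Gaussian ground states -/

section GroundState

variable {a c γ : ℝ} (ha : 0 < a) (hc : 0 < c)

lemma magOp₁_gaussianState : magOp₁ B (gaussianState ha hc γ) =
    (Complex.I * a) • posOp 0 (gaussianState ha hc γ) +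
      ((γ + B / 2 : ℝ) : ℂ) • posOp 1 (gaussianState ha hc γ) := by
  ext x
  change _ = Complex.I * a * posOp 0 (gaussianState ha hc γ) x +
    ((γ + B / 2 : ℝ) : ℂ) * posOp 1 (gaussianState ha hc γ) x
  rw [coe_magOp₁, magMomentum₁, partialDeriv_gaussianState, posOp_apply, posOp_apply, if_pos rfl]
  push_cast
  linear_combination (-(γ : ℂ) * x 1 * gaussianState ha hc γ x) * Complex.I_sq

lemma magOp₂_gaussianState : magOp₂ B (gaussianState ha hc γ) =
    ((γ - B / 2 : ℝ) : ℂ) • posOp 0 (gaussianState ha hc γ) +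
      (Complex.I * c) • posOp 1 (gaussianState ha hc γ) := by
  ext x
  change _ = ((γ - B / 2 : ℝ) : ℂ) * posOp 0 (gaussianState ha hc γ) x +
    Complex.I * c * posOp 1 (gaussianState ha hc γ) x
  rw [coe_magOp₂, magMomentum₂, partialDeriv_gaussianState, posOp_apply, posOp_apply,
    if_neg one_ne_zero]
  push_cast
  linear_combination (-(γ : ℂ) * x 0 * gaussianState ha hc γ x) * Complex.I_sq

/-- On a Gaussian the magnetic momenta act as multiplication by linear functions; the two hypotheses
say that the total coefficients of `x₁` and `x₂` vanish. -/
lemma linOp_gaussianState_eq_zero {α₁ α₂ β₁ β₂ : ℂ}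
    (h₀ : α₁ * (Complex.I * a) + α₂ * ((γ - B / 2 : ℝ) : ℂ) + β₁ = 0)
    (h₁ : α₁ * ((γ + B / 2 : ℝ) : ℂ) + α₂ * (Complex.I * c) + β₂ = 0) :
    linOp B α₁ α₂ β₁ β₂ (gaussianState ha hc γ) = 0 := by
  simp only [linOp, LinearMap.add_apply, LinearMap.smul_apply]
  rw [magOp₁_gaussianState, magOp₂_gaussianState, eq_neg_of_add_eq_zero_right h₀,
    eq_neg_of_add_eq_zero_right h₁]
  module

/-- The hypotheses cancel the coefficients of `x₁²`, `x₂²` and `x₁x₂`; the constant `a + c` comes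
from commuting the momenta past the coordinates. -/
lemma oscOp_gaussianState (μ : ℝ) (h₀ : a ^ 2 = ω₁ ^ 2 + (γ - B / 2) ^ 2)
    (h₁ : c ^ 2 = ω₂ ^ 2 + (γ + B / 2) ^ 2) (h₂ : a * (γ + B / 2) + c * (γ - B / 2) = 0) :
    oscOp B ω₁ ω₂ μ (gaussianState ha hc γ) =
      ((a + c - μ : ℝ) : ℂ) • gaussianState ha hc γ := by
  have h₀' : (a : ℂ) ^ 2 = ω₁ ^ 2 + (γ - B / 2) ^ 2 := by exact_mod_cast h₀
  have h₁' : (c : ℂ) ^ 2 = ω₂ ^ 2 + (γ + B / 2) ^ 2 := by exact_mod_cast h₁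
  have h₂' : (a : ℂ) * (γ + B / 2) + c * (γ - B / 2) = 0 := by exact_mod_cast h₂
  have hm₁ : ∀ (j : Fin 2) (f : 𝓢(Plane, ℂ)), magOp₁ B (posOp j f) =
      posOp j (magOp₁ B f) + (if j = 0 then -Complex.I else 0) • f := fun j f =>
    congrArg (fun p : Module.End ℂ 𝓢(Plane, ℂ) => p f) (mul_eq_of_opComm (opComm_magOp₁_posOp B j))
  have hm₂ : ∀ (j : Fin 2) (f : 𝓢(Plane, ℂ)), magOp₂ B (posOp j f) =
      posOp j (magOp₂ B f) + (if j = 1 then -Complex.I else 0) • f := fun j f =>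
    congrArg (fun p : Module.End ℂ 𝓢(Plane, ℂ) => p f) (mul_eq_of_opComm (opComm_magOp₂_posOp B j))
  simp only [oscOp, LinearMap.sub_apply, LinearMap.add_apply, LinearMap.smul_apply,
    Module.End.mul_apply, Module.End.one_apply, magOp₁_gaussianState, magOp₂_gaussianState,
    map_add, map_smul, hm₁, hm₂, if_true, one_ne_zero, zero_ne_one, if_false, zero_smul, add_zero]
  have hcomm : posOp 1 (posOp 0 (gaussianState ha hc γ)) =
      posOp 0 (posOp 1 (gaussianState ha hc γ)) :=
    congrArg (fun p : Module.End ℂ 𝓢(Plane, ℂ) => p (gaussianState ha hc γ)) (posOp_mul_comm 1 0)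
  rw [hcomm]
  generalize posOp 0 (posOp 0 (gaussianState ha hc γ)) = u₀₀
  generalize posOp 0 (posOp 1 (gaussianState ha hc γ)) = u₀₁
  generalize posOp 1 (posOp 1 (gaussianState ha hc γ)) = u₁₁
  generalize gaussianState ha hc γ = u
  push_cast
  have e00 : (Complex.I * a) * (Complex.I * a) + (γ - B / 2) * (γ - B / 2) + (ω₁ : ℂ) ^ 2 = 0 := by
    linear_combination (a : ℂ) ^ 2 * Complex.I_sq - h₀'
  have e11 : (γ + B / 2) * (γ + B / 2) + (Complex.I * c) * (Complex.I * c) + (ω₂ : ℂ) ^ 2 = 0 := by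
    linear_combination (c : ℂ) ^ 2 * Complex.I_sq - h₁'
  have e01 : 2 * (Complex.I * a) * (γ + B / 2) + 2 * (γ - B / 2) * (Complex.I * c) = 0 := by
    linear_combination 2 * Complex.I * h₂'
  have e : (Complex.I * a) * (-Complex.I) + (Complex.I * c) * (-Complex.I) - μ = (a : ℂ) + c - μ := by
    linear_combination (-(a : ℂ) - c) * Complex.I_sq
  rw [← e]
  linear_combination (norm := module) e00 • u₀₀ + e01 • u₀₁ + e11 • u₁₁

end GroundState

end Diagonalization

end

noncomputable section

/-! ### Eigenbasis and spectrum of the magnetic oscillator -/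

section Spectrum

variable {B ω₁ ω₂ ν ν' : ℝ}

namespace IsFreqPair

lemma ground_pos₁ (h : IsFreqPair B ω₁ ω₂ ν ν') : 0 < (ν + ν') * (ω₁ / (ω₁ + ω₂)) :=
  mul_pos (add_pos h.hν h.hν') (div_pos h.hω₁ (add_pos h.hω₁ h.hω₂))

lemma ground_pos₂ (h : IsFreqPair B ω₁ ω₂ ν ν') : 0 < (ν + ν') * (ω₂ / (ω₁ + ω₂)) :=
  mul_pos (add_pos h.hν h.hν') (div_pos h.hω₂ (add_pos h.hω₁ h.hω₂))

/-- The ground state of the magnetic oscillator. -/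
def ground (h : IsFreqPair B ω₁ ω₂ ν ν') : 𝓢(Plane, ℂ) :=
  gaussianState h.ground_pos₁ h.ground_pos₂ (B * (ω₂ - ω₁) / (2 * (ω₁ + ω₂)))

lemma phase_add (h : IsFreqPair B ω₁ ω₂ ν ν') :
    B * (ω₂ - ω₁) / (2 * (ω₁ + ω₂)) + B / 2 = B * (ω₂ / (ω₁ + ω₂)) := by
  have := (add_pos h.hω₁ h.hω₂).ne'
  field_simp
  ring

lemma phase_sub (h : IsFreqPair B ω₁ ω₂ ν ν') :
    B * (ω₂ - ω₁) / (2 * (ω₁ + ω₂)) - B / 2 = -(B * (ω₁ / (ω₁ + ω₂))) := by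
  have := (add_pos h.hω₁ h.hω₂).ne'
  field_simp
  ring

lemma lowerOp_ground (h : IsFreqPair B ω₁ ω₂ ν ν') : lowerOp B ω₁ ν h.ground = 0 := by
  have hΩ := (add_pos h.hω₁ h.hω₂).ne'
  have hν := h.hν.ne'
  refine linOp_gaussianState_eq_zero _ _ ?_ ?_
  · rw [h.phase_sub]
    have : B * ν * ((ν + ν') * (ω₁ / (ω₁ + ω₂))) + (ν ^ 2 - ω₁ ^ 2) * -(B * (ω₁ / (ω₁ + ω₂)))
        - ω₁ ^ 2 * B = 0 := by
      field_simp
      linear_combination B * ω₁ * h.mul_eq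
    have h2 : ((B * ν * ((ν + ν') * (ω₁ / (ω₁ + ω₂))) +
        (ν ^ 2 - ω₁ ^ 2) * -(B * (ω₁ / (ω₁ + ω₂))) - ω₁ ^ 2 * B : ℝ) : ℂ) = 0 := by
      rw [this]; simp
    push_cast at h2 ⊢
    linear_combination Complex.I * h2
  · rw [h.phase_add]
    have : B * ν * (B * (ω₂ / (ω₁ + ω₂))) - (ν ^ 2 - ω₁ ^ 2) * ((ν + ν') * (ω₂ / (ω₁ + ω₂)))
        + (ν * (ν ^ 2 - ω₁ ^ 2) - B ^ 2 * ν) = 0 := by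
      -- The factor `ν` leaves only `ν²` and `ν ν'`, to which `quartic` and `mul_eq` apply.
      refine (mul_eq_zero.1 (?_ : ν * _ = 0)).resolve_left hν
      field_simp
      linear_combination ω₁ * h.quartic - ω₂ * (ν ^ 2 - ω₁ ^ 2) * h.mul_eq
    have h2 : ((B * ν * (B * (ω₂ / (ω₁ + ω₂))) -
        (ν ^ 2 - ω₁ ^ 2) * ((ν + ν') * (ω₂ / (ω₁ + ω₂)))
        + (ν * (ν ^ 2 - ω₁ ^ 2) - B ^ 2 * ν) : ℝ) : ℂ) = 0 := by
      rw [this]; simp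
    push_cast at h2 ⊢
    linear_combination h2 + ((ν : ℂ) ^ 2 - ω₁ ^ 2) * ((ν + ν') * (ω₂ / (ω₁ + ω₂))) * Complex.I_sq

/-- The Gaussian depends on the frequencies only through their sum, so one vacuum serves both modes.
-/
lemma ground_symm (h : IsFreqPair B ω₁ ω₂ ν ν') : h.symm.ground = h.ground := by
  ext x
  rw [ground, ground, gaussianState_apply, gaussianState_apply, add_comm ν' ν]

lemma oscOp_ground (h : IsFreqPair B ω₁ ω₂ ν ν') (μ : ℝ) :
    oscOp B ω₁ ω₂ μ h.ground = ((ν + ν' - μ : ℝ) : ℂ) • h.ground := by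
  have hΩ := (add_pos h.hω₁ h.hω₂).ne'
  have h1 := oscOp_gaussianState (B := B) (ω₁ := ω₁) (ω₂ := ω₂)
    (γ := B * (ω₂ - ω₁) / (2 * (ω₁ + ω₂))) h.ground_pos₁ h.ground_pos₂ μ ?_ ?_ ?_
  · rw [ground, h1]
    congr 2
    rw [← mul_add, ← add_div, div_self hΩ, mul_one]
  · rw [h.phase_sub, mul_pow, h.sum_sq]
    field_simp
  · rw [h.phase_add, mul_pow, h.sum_sq]
    field_simp
  · rw [h.phase_add, h.phase_sub]
    ring

lemma schwartzToL2_ground_ne (h : IsFreqPair B ω₁ ω₂ ν ν') : schwartzToL2 h.ground ≠ 0 := by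
  intro h0
  have h1 : h.ground = 0 := SchwartzMap.injective_toLp 2 volume (h0.trans (map_zero schwartzToL2).symm)
  have h2 : h.ground 0 = 0 := by rw [h1]; rfl
  rw [ground, gaussianState_apply] at h2
  exact Complex.exp_ne_zero _ h2

lemma isLadderPair (h : IsFreqPair B ω₁ ω₂ ν ν') :
    IsLadderPair schwartzToL2 (lowerOp B ω₁ ν) (raiseOp B ω₁ ν) (lowerOp B ω₁ ν')
      (raiseOp B ω₁ ν') (ladderConst B ω₁ ν) (ladderConst B ω₁ ν') h.ground where
  ca_pos := h.ladderConst_pos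
  cb_pos := h.symm.ladderConst_pos
  lie_a := lowerOp_mul_raiseOp B ω₁ ν
  lie_b := lowerOp_mul_raiseOp B ω₁ ν'
  comm := h.commute_raiseOp
  comm_a := h.commute_lowerOp_raiseOp
  comm_b := h.symm.commute_lowerOp_raiseOp
  adj_a := adj_lowerOp B ω₁ ν
  adj_b := adj_lowerOp B ω₁ ν'
  vac_a := h.lowerOp_ground
  vac_b := by rw [← h.ground_symm, h.symm.lowerOp_ground]
  vac_ne := h.schwartzToL2_ground_ne

/-- The difference of lowering and raising operators involves only `π₂` and `x₁`; two frequencies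
suffice to eliminate `π₂`. The sum likewise involves only `π₁` and `x₂`. -/
lemma _root_.posOp_zero_eq (B ω₁ ν ν' : ℝ) :
    (2 * Complex.I * ω₁ ^ 2 * B * ((ν : ℂ) ^ 2 - ν' ^ 2)) • posOp 0 =
      ((ν' : ℂ) ^ 2 - ω₁ ^ 2) • (lowerOp B ω₁ ν - raiseOp B ω₁ ν) -
        ((ν : ℂ) ^ 2 - ω₁ ^ 2) • (lowerOp B ω₁ ν' - raiseOp B ω₁ ν') := by
  simp only [lowerOp, raiseOp, linOp]
  module

lemma _root_.posOp_one_eq (B ω₁ ν ν' : ℝ) :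
    (2 * (ν : ℂ) * ν' * (ν ^ 2 - ν' ^ 2)) • posOp 1 =
      (ν' : ℂ) • (lowerOp B ω₁ ν + raiseOp B ω₁ ν) -
        (ν : ℂ) • (lowerOp B ω₁ ν' + raiseOp B ω₁ ν') := by
  simp only [lowerOp, raiseOp, linOp]
  module

lemma posOp_mem_span (h : IsFreqPair B ω₁ ω₂ ν ν') (j : Fin 2) (u : 𝓢(Plane, ℂ))
    (hu : u ∈ Submodule.span ℂ (Set.range
      (ladderState (raiseOp B ω₁ ν) (raiseOp B ω₁ ν') h.ground))) :
    posOp j u ∈ Submodule.span ℂ (Set.range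
      (ladderState (raiseOp B ω₁ ν) (raiseOp B ω₁ ν') h.ground)) := by
  set W := Submodule.span ℂ (Set.range
      (ladderState (raiseOp B ω₁ ν) (raiseOp B ω₁ ν') h.ground))
  obtain ⟨h1, h2, h3, h4⟩ := h.isLadderPair.span_invariant u hu
  -- Distinctness of the frequencies is what allows solving for the coordinates.
  have hsq : ((ν : ℂ) ^ 2 - ν' ^ 2) ≠ 0 := by exact_mod_cast h.sq_ne
  have hB : (B : ℂ) ≠ 0 := by exact_mod_cast h.hB.ne'
  have hω₁ : (ω₁ : ℂ) ≠ 0 := by exact_mod_cast h.hω₁.ne'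
  have hν : (ν : ℂ) ≠ 0 := by exact_mod_cast h.hν.ne'
  have hν' : (ν' : ℂ) ≠ 0 := by exact_mod_cast h.hν'.ne'
  fin_cases j
  · have hne : 2 * Complex.I * (ω₁ : ℂ) ^ 2 * B * (ν ^ 2 - ν' ^ 2) ≠ 0 := by
      simp [hsq, hB, hω₁]
    have h5 := congrArg (fun p : Module.End ℂ 𝓢(Plane, ℂ) => p u) (posOp_zero_eq B ω₁ ν ν')
    refine (W.smul_mem_iff hne).1 ?_
    refine (congrArg (· ∈ W) h5).mpr ?_
    exact W.sub_mem (W.smul_mem _ (W.sub_mem h1 h2)) (W.smul_mem _ (W.sub_mem h3 h4))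
  · have hne : 2 * (ν : ℂ) * ν' * (ν ^ 2 - ν' ^ 2) ≠ 0 := by
      simp [hsq, hν, hν']
    have h5 := congrArg (fun p : Module.End ℂ 𝓢(Plane, ℂ) => p u) (posOp_one_eq B ω₁ ν ν')
    refine (W.smul_mem_iff hne).1 ?_
    refine (congrArg (· ∈ W) h5).mpr ?_
    exact W.sub_mem (W.smul_mem _ (W.add_mem h1 h2)) (W.smul_mem _ (W.add_mem h3 h4))

/-- The Hilbert basis of eigenfunctions of the magnetic oscillator. -/
def eigenbasis (h : IsFreqPair B ω₁ ω₂ ν ν') : HilbertBasis (ℕ × ℕ) ℂ L2Plane :=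
  HilbertBasis.mkOfOrthogonalEqBot h.isLadderPair.orthonormal <| by
    rw [Submodule.eq_bot_iff]
    intro f hf
    rw [Submodule.mem_orthogonal] at hf
    refine eq_zero_of_orthogonal h.ground_pos₁ h.ground_pos₂
      (B * (ω₂ - ω₁) / (2 * (ω₁ + ω₂))) _ ?_ h.posOp_mem_span f
      fun u hu => hf _ (h.isLadderPair.apply_normalizedState_mem u hu)
    exact Submodule.subset_span ⟨(0, 0), by simp [ladderState, ground]⟩

lemma eigenbasis_apply (h : IsFreqPair B ω₁ ω₂ ν ν') (p : ℕ × ℕ) :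
    h.eigenbasis p = schwartzToL2 (IsLadderPair.normalizedState schwartzToL2
      (raiseOp B ω₁ ν) (raiseOp B ω₁ ν') h.ground p) := by
  rw [eigenbasis, HilbertBasis.coe_mkOfOrthogonalEqBot]

lemma oscOp_normalizedState (h : IsFreqPair B ω₁ ω₂ ν ν') (μ : ℝ) (p : ℕ × ℕ) :
    oscOp B ω₁ ω₂ μ (IsLadderPair.normalizedState schwartzToL2
      (raiseOp B ω₁ ν) (raiseOp B ω₁ ν') h.ground p) =
      (((2 * p.1 + 1) * ν + (2 * p.2 + 1) * ν' - μ : ℝ) : ℂ) •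
        IsLadderPair.normalizedState schwartzToL2
          (raiseOp B ω₁ ν) (raiseOp B ω₁ ν') h.ground p := by
  rw [IsLadderPair.normalizedState, map_smul,
    ladderState_eigen (h.oscOp_mul_raiseOp μ) (h.symm.oscOp_mul_raiseOp μ) (h.oscOp_ground μ),
    smul_comm]
  congr 2
  push_cast
  ring

/-- The eigenfunctions are Schwartz, so their pairs lie in the graph before closure; symmetry of the
graph is integration by parts. -/
theorem isDiagonal_magSchrodinger (h : IsFreqPair B ω₁ ω₂ ν ν') (μ : ℝ) :
    IsDiagonal h.eigenbasis (fun p => (2 * p.1 + 1) * ν + (2 * p.2 + 1) * ν' - μ)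
      (magSchrodinger B (oscPotential ω₁ ω₂ μ)) := by
  refine isDiagonal_closure _ _ _ ?_ ?_
  · intro p
    refine ⟨IsLadderPair.normalizedState schwartzToL2
      (raiseOp B ω₁ ν) (raiseOp B ω₁ ν') h.ground p, ?_, ?_⟩
    · rw [eigenbasis_apply]
      exact coeFn_schwartzToL2 _
    · rw [eigenbasis_apply, ← map_smul, ← h.oscOp_normalizedState, ← coe_oscOp]
      exact coeFn_schwartzToL2 _
  · have key : ∀ p ∈ magSchrodingerGraph B (oscPotential ω₁ ω₂ μ), ∃ f : 𝓢(Plane, ℂ),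
        p.1 = schwartzToL2 f ∧ p.2 = schwartzToL2 (oscOp B ω₁ ω₂ μ f) := by
      rintro p ⟨f, h1, h2⟩
      refine ⟨f, Lp.ext (h1.trans (coeFn_schwartzToL2 f).symm), Lp.ext (h2.trans ?_)⟩
      rw [← coe_oscOp]
      exact (coeFn_schwartzToL2 _).symm
    intro p hp q hq
    obtain ⟨f, h1, h2⟩ := key p hp
    obtain ⟨g, h3, h4⟩ := key q hq
    rw [h1, h2, h3, h4, oscOp_adj]

end IsFreqPair

end Spectrum

end

noncomputable section

/-! ### The semiclassical integral -/

section Semiclassical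

lemma lintegral_comp_diagonal {ω₁ ω₂ : ℝ} (h₁ : 0 < ω₁) (h₂ : 0 < ω₂) {F : Plane → ℝ≥0∞}
    (hF : Measurable F) :
    ∫⁻ x : Plane, F (!₂[ω₁ * x 0, ω₂ * x 1]) = ENNReal.ofReal (ω₁ * ω₂)⁻¹ * ∫⁻ x, F x := by
  set L : Plane →ₗ[ℝ] Plane := Matrix.toLpLin 2 2 (Matrix.diagonal ![ω₁, ω₂]) with hL
  have hdet : LinearMap.det L = ω₁ * ω₂ := by
    rw [hL, Matrix.toLpLin_eq_toLin, LinearMap.det_toLin, Matrix.det_diagonal]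
    simp
  have hLx : ∀ x : Plane, L x = !₂[ω₁ * x 0, ω₂ * x 1] := by
    intro x
    ext i
    rw [hL, Matrix.toLpLin_apply]
    fin_cases i <;> simp [Matrix.mulVec_diagonal]
  have hmeas : Measurable L := L.continuous_of_finiteDimensional.measurable
  have hmap := Measure.map_linearMap_addHaar_eq_smul_addHaar (volume : Measure Plane) (f := L)
    (by rw [hdet]; positivity)
  calc ∫⁻ x : Plane, F (!₂[ω₁ * x 0, ω₂ * x 1]) = ∫⁻ x, F (L x) := by simp_rw [hLx]
    _ = ∫⁻ y, F y ∂(Measure.map L volume) := (lintegral_map hF hmeas).symm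
    _ = _ := by
      rw [hmap, lintegral_smul_measure, hdet, abs_of_pos (by positivity), smul_eq_mul]

lemma integral_Ioi_mul_negPart {E : ℝ} (hE : 0 ≤ E) :
    ∫ r in Set.Ioi (0 : ℝ), r * (r ^ 2 - E)⁻ = E ^ 2 / 4 := by
  have hs : 0 ≤ √E := Real.sqrt_nonneg E
  have hsq : √E ^ 2 = E := Real.sq_sqrt hE
  have h1 : ∫ r in Set.Ioi (0 : ℝ), r * (r ^ 2 - E)⁻ = ∫ r in Set.Ioc 0 (√E), r * (r ^ 2 - E)⁻ := by
    refine setIntegral_eq_of_subset_of_forall_sdiff_eq_zero measurableSet_Ioi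
      Set.Ioc_subset_Ioi_self fun r (hr : r ∈ Set.Ioi 0 \ Set.Ioc 0 (√E)) => ?_
    have hr1 : √E ≤ r := le_of_lt (not_le.1 fun h => hr.2 ⟨hr.1, h⟩)
    have hr2 : 0 ≤ r ^ 2 - E := by nlinarith
    rw [negPart_eq_zero.2 hr2, mul_zero]
  have h2 : ∫ r in Set.Ioc 0 (√E), r * (r ^ 2 - E)⁻ = ∫ r in Set.Ioc 0 (√E), (E * r - r ^ 3) := by
    refine setIntegral_congr_fun measurableSet_Ioc fun r hr => ?_
    have hr2 : r ^ 2 - E ≤ 0 := by nlinarith [hr.1, hr.2]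
    change r * (r ^ 2 - E)⁻ = E * r - r ^ 3
    rw [negPart_of_nonpos hr2]
    ring
  rw [h1, h2, ← intervalIntegral.integral_of_le hs, intervalIntegral.integral_sub
    (Continuous.intervalIntegrable (by fun_prop) _ _)
    (Continuous.intervalIntegrable (by fun_prop) _ _), intervalIntegral.integral_const_mul, integral_id, integral_pow]
  have : √E ^ 4 = E ^ 2 := by
    calc √E ^ 4 = (√E ^ 2) ^ 2 := by ring
      _ = E ^ 2 := by rw [hsq]
  norm_num
  rw [this, hsq]
  ring

lemma lintegral_negPart_norm_sq (E : ℝ) :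
    ∫⁻ x : Plane, ENNReal.ofReal ((‖x‖ ^ 2 - E)⁻) = ENNReal.ofReal (Real.pi / 2 * E⁺ ^ 2) := by
  rcases le_total E 0 with hE | hE
  · have : ∀ x : Plane, (‖x‖ ^ 2 - E)⁻ = 0 := fun x =>
      negPart_eq_zero.2 (by nlinarith [sq_nonneg ‖x‖])
    simp [this, posPart_eq_zero.2 hE]
  have hcont : Continuous fun x : Plane => (‖x‖ ^ 2 - E)⁻ := by
    simp only [negPart_def]
    fun_prop
  have hgint : Integrable fun x : Plane => (‖x‖ ^ 2 - E)⁻ := by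
    refine hcont.integrable_of_hasCompactSupport
      (HasCompactSupport.intro (isCompact_closedBall (0 : Plane) (√E)) fun x hx => ?_)
    have hx' : √E < ‖x‖ := by simpa using hx
    refine negPart_eq_zero.2 ?_
    nlinarith [Real.sqrt_nonneg E, Real.sq_sqrt hE]
  rw [← ofReal_integral_eq_lintegral_ofReal hgint
    (Filter.Eventually.of_forall fun x => negPart_nonneg _),
    integral_fun_norm_addHaar volume (fun r => (r ^ 2 - E)⁻)]
  have hball : (volume : Measure Plane).real (Metric.ball 0 1) = Real.pi := by
    rw [Measure.real, EuclideanSpace.volume_ball_fin_two]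
    simp [Real.pi_pos.le]
  rw [hball, posPart_of_nonneg hE]
  simp only [finrank_euclideanSpace, Fintype.card_fin, Nat.add_one_sub_one, pow_one, smul_eq_mul,
    nsmul_eq_mul]
  rw [integral_Ioi_mul_negPart hE]
  congr 1
  push_cast
  ring

/-- Rescaling each coordinate by its frequency makes the potential radial, at the cost of the
Jacobian `1/(ω₁ω₂)`. -/
lemma lintegral_oscPotential {ω₁ ω₂ : ℝ} (h₁ : 0 < ω₁) (h₂ : 0 < ω₂) (μ b : ℝ) :
    ∫⁻ x : Plane, ENNReal.ofReal ((b + oscPotential ω₁ ω₂ μ x)⁻) =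
      ENNReal.ofReal (Real.pi / (2 * (ω₁ * ω₂)) * (μ - b)⁺ ^ 2) := by
  have h := lintegral_comp_diagonal h₁ h₂
    (F := fun y : Plane => ENNReal.ofReal ((‖y‖ ^ 2 - (μ - b))⁻)) (by
      have : Continuous fun x : Plane => (‖x‖ ^ 2 - (μ - b))⁻ := by
        simp only [negPart_def]
        fun_prop
      exact ENNReal.measurable_ofReal.comp this.measurable)
  rw [lintegral_negPart_norm_sq, ← ENNReal.ofReal_mul (by positivity)] at h
  have h3 : ∀ x : Plane, ‖(!₂[ω₁ * x 0, ω₂ * x 1] : Plane)‖ ^ 2 - (μ - b) =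
      b + oscPotential ω₁ ω₂ μ x := by
    intro x
    rw [norm_sq_plane, oscPotential]
    simp only [Matrix.cons_val_zero, Matrix.cons_val_one]
    ring
  simp_rw [h3] at h
  rw [h]
  congr 1
  field_simp

lemma magSemiclassical_oscPotential {B ω₁ ω₂ : ℝ} (hB : 0 < B) (h₁ : 0 < ω₁) (h₂ : 0 < ω₂)
    (μ : ℝ) : magSemiclassical B (oscPotential ω₁ ω₂ μ) =
      ∑' m : ℕ, ENNReal.ofReal (B / (4 * (ω₁ * ω₂)) * (μ - (2 * m + 1) * B)⁺ ^ 2) := by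
  rw [magSemiclassical, ← ENNReal.tsum_mul_left]
  refine tsum_congr fun m => ?_
  rw [lintegral_oscPotential h₁ h₂, ← ENNReal.ofReal_mul (by positivity)]
  congr 1
  have := Real.pi_pos.ne'
  field_simp
  ring

end Semiclassical

/-! ### Riemann sums -/

section RiemannSums

/-- The right side is twice the integral of the convex function `s₊` over `[t - h, t + h]`; the left
side is twice its midpoint approximation. -/
lemma four_mul_posPart_le {h : ℝ} (hh : 0 < h) (t : ℝ) :
    4 * h * t⁺ ≤ (t + h)⁺ ^ 2 - (t - h)⁺ ^ 2 := by
  simp only [posPart_def]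
  rcases le_total t 0 with h1 | h1
  · rw [max_eq_right h1, max_eq_right (by linarith : t - h ≤ 0)]
    simp only [mul_zero]
    nlinarith [sq_nonneg (max (t + h) 0)]
  · rw [max_eq_left h1, max_eq_left (by linarith : 0 ≤ t + h)]
    rcases le_total t h with h2 | h2
    · rw [max_eq_right (by linarith : t - h ≤ 0)]
      nlinarith [sq_nonneg (t - h)]
    · rw [max_eq_left (by linarith : 0 ≤ t - h)]
      nlinarith

/-- Here twice the integral of `s₊` over `[t - 2h, t]` is bounded by the value at the right
endpoint. -/
lemma le_four_mul_posPart {h : ℝ} (hh : 0 < h) (t : ℝ) :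
    t⁺ ^ 2 - (t - 2 * h)⁺ ^ 2 ≤ 4 * h * t⁺ := by
  simp only [posPart_def]
  rcases le_total t 0 with h1 | h1
  · rw [max_eq_right h1]
    nlinarith [sq_nonneg (max (t - 2 * h) 0)]
  · rw [max_eq_left h1]
    rcases le_total t (2 * h) with h2 | h2
    · rw [max_eq_right (by linarith : t - 2 * h ≤ 0)]
      nlinarith
    · rw [max_eq_left (by linarith : 0 ≤ t - 2 * h)]
      nlinarith

/-- Midpoint sums of a convex function are bounded by the integral. -/
lemma tsum_negPart_le {h : ℝ} (hh : 0 < h) (E : ℝ) :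
    ∑' k : ℕ, ENNReal.ofReal (((2 * k + 1) * h - E)⁻) ≤ ENNReal.ofReal (E⁺ ^ 2 / (4 * h)) := by
  rw [ENNReal.tsum_eq_iSup_nat]
  refine iSup_le fun n => ?_
  rw [← ENNReal.ofReal_sum_of_nonneg fun _ _ => negPart_nonneg _]
  refine ENNReal.ofReal_le_ofReal ?_
  have h1 : ∀ k ∈ Finset.range n, ((2 * k + 1) * h - E)⁻ ≤
      (E - 2 * (k : ℕ) * h)⁺ ^ 2 / (4 * h) - (E - 2 * ((k + 1 : ℕ) : ℝ) * h)⁺ ^ 2 / (4 * h) := by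
    intro k _
    have h2 := four_mul_posPart_le hh (E - (2 * k + 1) * h)
    rw [← sub_div, le_div_iff₀ (by positivity), ← posPart_neg, neg_sub, mul_comm]
    refine h2.trans (le_of_eq ?_)
    push_cast
    ring_nf
  refine (Finset.sum_le_sum h1).trans ?_
  rw [Finset.sum_range_sub' (fun k : ℕ => (E - 2 * (k : ℝ) * h)⁺ ^ 2 / (4 * h))]
  have : 0 ≤ (E - 2 * (n : ℝ) * h)⁺ ^ 2 / (4 * h) := by positivity
  simpa using this

/-- Sums of a nonincreasing function are bounded from below by the integral. -/
lemma le_tsum_negPart {h : ℝ} (hh : 0 < h) (E : ℝ) :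
    ENNReal.ofReal ((E - h)⁺ ^ 2 / (4 * h)) ≤
      ∑' k : ℕ, ENNReal.ofReal (((2 * k + 1) * h - E)⁻) := by
  obtain ⟨n, hn⟩ := exists_nat_gt (E / h)
  rw [div_lt_iff₀ hh] at hn
  refine le_trans ?_ (ENNReal.sum_le_tsum (Finset.range n))
  rw [← ENNReal.ofReal_sum_of_nonneg fun _ _ => negPart_nonneg _]
  refine ENNReal.ofReal_le_ofReal ?_
  -- The intervals now have right endpoints `E - (2k+1)h`, so telescoping starts at `E - h` rather
  -- than `E`; the choice of `n` kills the last term.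
  have h1 : ∀ k ∈ Finset.range n, (E - (2 * (k : ℕ) + 1) * h)⁺ ^ 2 / (4 * h) -
      (E - (2 * ((k + 1 : ℕ) : ℝ) + 1) * h)⁺ ^ 2 / (4 * h) ≤ ((2 * k + 1) * h - E)⁻ := by
    intro k _
    have h2 := le_four_mul_posPart hh (E - (2 * k + 1) * h)
    rw [← sub_div, div_le_iff₀ (by positivity), ← posPart_neg, neg_sub, mul_comm _ (4 * h)]
    refine (le_of_eq ?_).trans h2
    push_cast
    ring_nf
  refine le_trans ?_ (Finset.sum_le_sum h1)
  rw [Finset.sum_range_sub' (fun k : ℕ => (E - (2 * (k : ℝ) + 1) * h)⁺ ^ 2 / (4 * h))]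
  have : (E - (2 * (n : ℝ) + 1) * h)⁺ = 0 := posPart_eq_zero.2 (by nlinarith)
  rw [this]
  simp

/-- Squaring removes the kink at zero: the first-order Taylor error is at most `(y - x)²`. -/
lemma hasDerivAt_posPart_sq (x : ℝ) : HasDerivAt (fun y : ℝ => y⁺ ^ 2) (2 * x⁺) x := by
  rw [hasDerivAt_iff_isLittleO]
  have h1 : (fun y : ℝ => (y - x) ^ 2) =o[nhds x] fun y => y - x := by
    have := Asymptotics.isLittleO_pow_sub_sub x (one_lt_two)
    simpa using this
  refine Asymptotics.IsBigO.trans_isLittleO (Asymptotics.IsBigO.of_bound 1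
    (Filter.Eventually.of_forall fun y => ?_)) h1
  rw [Real.norm_eq_abs, Real.norm_of_nonneg (sq_nonneg (y - x)), one_mul, abs_le, smul_eq_mul]
  simp only [posPart_def]
  rcases le_total x 0 with hx | hx <;> rcases le_total y 0 with hy | hy <;>
    simp only [max_eq_left, max_eq_right, hx, hy] <;> constructor <;> nlinarith

lemma sum_range_quadratic (μ t : ℝ) (n : ℕ) :
    ∑ j ∈ Finset.range n, (μ - (2 * j + 1) * t) * (μ - 3 * ((2 * j + 1) * t)) =
      n * ((μ - 2 * n * t) ^ 2 - t ^ 2) := by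
  induction n with
  | zero => simp
  | succ n ih =>
    rw [Finset.sum_range_succ, ih]
    push_cast
    ring

/-- If `n` terms are active, then `(2n-1)t < μ ≤ (2n+1)t` whenever `n > 0`. Thus `|μ - 2nt| ≤ t`,
and the closed form `n((μ - 2nt)² - t²)` is nonpositive. -/
lemma sum_deriv_nonpos {μ t : ℝ} (ht : 0 < t) {M : ℕ} (hM : μ ≤ (2 * M + 1) * t) :
    ∑ j ∈ Finset.range M, (μ - (2 * j + 1) * t)⁺ * (μ - 3 * ((2 * j + 1) * t)) ≤ 0 := by
  classical
  have hex : ∃ n : ℕ, μ ≤ (2 * n + 1) * t := ⟨M, hM⟩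
  set n := Nat.find hex with hn
  have hnM : n ≤ M := Nat.find_min' hex hM
  have hspec : μ ≤ (2 * n + 1) * t := Nat.find_spec hex
  have h1 : ∑ j ∈ Finset.range M, (μ - (2 * j + 1) * t)⁺ * (μ - 3 * ((2 * j + 1) * t)) =
      ∑ j ∈ Finset.range n, (μ - (2 * j + 1) * t) * (μ - 3 * ((2 * j + 1) * t)) := by
    rw [← Finset.sum_subset (Finset.range_mono hnM)]
    · refine Finset.sum_congr rfl fun j hj => ?_
      have := Nat.find_min hex (Finset.mem_range.1 hj)
      rw [posPart_of_nonneg (by linarith)]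
    · intro j _ hj
      have hj' : (n : ℝ) ≤ j := by exact_mod_cast not_lt.1 fun h => hj (Finset.mem_range.2 h)
      rw [posPart_eq_zero.2 (by nlinarith), zero_mul]
  rw [h1, sum_range_quadratic]
  rcases Nat.eq_zero_or_pos n with h0 | h0
  · simp [h0]
  · have h2 := Nat.find_min hex (m := n - 1) (by lia)
    rw [Nat.cast_sub h0] at h2
    push_cast at h2
    refine mul_nonpos_of_nonneg_of_nonpos (by positivity) ?_
    nlinarith

/-- `t ∑ⱼ (μ - (2 j + 1) t)₊²` is nonincreasing in `t`. -/
lemma mul_sum_posPart_sq_le {B ν μ : ℝ} (hB : 0 < B) (hBν : B ≤ ν) {M : ℕ}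
    (hM : μ ≤ (2 * M + 1) * B) :
    ν * ∑ j ∈ Finset.range M, (μ - (2 * j + 1) * ν)⁺ ^ 2 ≤
      B * ∑ j ∈ Finset.range M, (μ - (2 * j + 1) * B)⁺ ^ 2 := by
  have hder : ∀ t : ℝ, HasDerivAt
      (fun t : ℝ => t * ∑ j ∈ Finset.range M, (μ - (2 * j + 1) * t)⁺ ^ 2)
      (∑ j ∈ Finset.range M, (μ - (2 * j + 1) * t)⁺ * (μ - 3 * ((2 * j + 1) * t))) t := by
    intro t
    have h1 : ∀ j ∈ Finset.range M, HasDerivAt (fun t : ℝ => (μ - (2 * (j : ℝ) + 1) * t)⁺ ^ 2)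
        (2 * (μ - (2 * (j : ℝ) + 1) * t)⁺ * (-(2 * (j : ℝ) + 1))) t := by
      intro j _
      have h2 : HasDerivAt (fun t : ℝ => μ - (2 * (j : ℝ) + 1) * t) (-(2 * (j : ℝ) + 1)) t := by
        simpa using ((hasDerivAt_id t).const_mul (2 * (j : ℝ) + 1)).const_sub μ
      exact (hasDerivAt_posPart_sq _).comp t h2
    have h3 := (hasDerivAt_id t).mul (HasDerivAt.fun_sum h1)
    refine h3.congr_deriv ?_
    simp only [id, one_mul]
    rw [Finset.mul_sum, ← Finset.sum_add_distrib]
    refine Finset.sum_congr rfl fun j _ => ?_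
    have h4 : (μ - (2 * (j : ℝ) + 1) * t)⁺ ^ 2 =
        (μ - (2 * (j : ℝ) + 1) * t)⁺ * (μ - (2 * (j : ℝ) + 1) * t) := by
      rcases le_total (μ - (2 * (j : ℝ) + 1) * t) 0 with h | h
      · rw [posPart_eq_zero.2 h]; simp
      · rw [posPart_of_nonneg h]; ring
    rw [h4]
    ring
  have hanti : AntitoneOn (fun t : ℝ => t * ∑ j ∈ Finset.range M, (μ - (2 * j + 1) * t)⁺ ^ 2)
      (Set.Ici B) := by
    refine antitoneOn_of_deriv_nonpos (convex_Ici B)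
      (fun t _ => (hder t).continuousAt.continuousWithinAt)
      (fun t _ => (hder t).differentiableAt.differentiableWithinAt) fun t ht => ?_
    rw [interior_Ici] at ht
    have ht' : B < t := ht
    rw [(hder t).deriv]
    -- The truncation at `M` still covers all active terms, as their number only drops when `t`
    -- grows.
    refine sum_deriv_nonpos (hB.trans ht') (hM.trans ?_)
    gcongr
  exact hanti Set.self_mem_Ici hBν hBν

end RiemannSums

end

noncomputable section

/-! ### The trace of the negative part -/

section Trace

variable {B ω₁ ω₂ ν ν' : ℝ}

namespace IsFreqPair

lemma exists_finset (h : IsFreqPair B ω₁ ω₂ ν ν') (μ : ℝ) : ∃ s : Finset (ℕ × ℕ), ∀ p, p ∉ s →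
    0 ≤ (2 * (p.1 : ℝ) + 1) * ν + (2 * (p.2 : ℝ) + 1) * ν' - μ := by
  obtain ⟨n, hn⟩ := exists_nat_gt (μ / ν)
  obtain ⟨n', hn'⟩ := exists_nat_gt (μ / ν')
  rw [div_lt_iff₀ h.hν] at hn
  rw [div_lt_iff₀ h.hν'] at hn'
  refine ⟨Finset.range n ×ˢ Finset.range n', fun p hp => ?_⟩
  have hν := h.hν
  have hν' := h.hν'
  have h1 : 0 ≤ (p.1 : ℝ) * ν := by positivity
  have h2 : 0 ≤ (p.2 : ℝ) * ν' := by positivity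
  rw [Finset.mem_product, Finset.mem_range, Finset.mem_range, not_and_or, not_lt, not_lt] at hp
  rcases hp with hp | hp
  · have : (n : ℝ) * ν ≤ p.1 * ν := by gcongr
    nlinarith
  · have : (n' : ℝ) * ν' ≤ p.2 * ν' := by gcongr
    nlinarith

lemma negTrace_eq (h : IsFreqPair B ω₁ ω₂ ν ν') (μ : ℝ) :
    negTrace (magSchrodinger B (oscPotential ω₁ ω₂ μ)) =
      ∑' j : ℕ, ∑' k : ℕ, ENNReal.ofReal
        (((2 * (k : ℝ) + 1) * ν' - (μ - (2 * (j : ℝ) + 1) * ν))⁻) := by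
  obtain ⟨s, hs⟩ := h.exists_finset μ
  rw [(h.isDiagonal_magSchrodinger μ).negTrace_eq hs, ENNReal.tsum_prod']
  refine tsum_congr fun j => tsum_congr fun k => ?_
  congr 2
  ring

/-- Trades `1/ν'`, produced by the sum over `k`, for the factor `ν` in the monotone quantity. -/
lemma inv_eq (h : IsFreqPair B ω₁ ω₂ ν ν') (x : ℝ) : x / (4 * ν') = ν * x / (4 * (ω₁ * ω₂)) := by
  have := h.hν.ne'
  have := h.hν'.ne'
  rw [← h.mul_eq]
  field_simp

theorem negTrace_le (h : IsFreqPair B ω₁ ω₂ ν ν') (hBν : B ≤ ν) (μ : ℝ) :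
    negTrace (magSchrodinger B (oscPotential ω₁ ω₂ μ)) ≤
      magSemiclassical B (oscPotential ω₁ ω₂ μ) := by
  have hB := h.hB
  have hw : 0 < 4 * (ω₁ * ω₂) := by
    have := h.hω₁
    have := h.hω₂
    positivity
  obtain ⟨M, hM⟩ := exists_nat_gt (μ / B)
  rw [div_lt_iff₀ hB] at hM
  have hvanish : ∀ t, B ≤ t → ∀ j ∉ Finset.range M, (μ - (2 * (j : ℝ) + 1) * t)⁺ = 0 := by
    intro t ht j hj
    have hj' : (M : ℝ) ≤ j := by exact_mod_cast not_lt.1 fun h => hj (Finset.mem_range.2 h)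
    refine posPart_eq_zero.2 ?_
    have h1 : (M : ℝ) * B ≤ j * t := by gcongr
    have h2 : 0 ≤ (j : ℝ) * t := by have := hB.trans_le ht; positivity
    nlinarith
  rw [h.negTrace_eq, magSemiclassical_oscPotential hB h.hω₁ h.hω₂]
  refine (ENNReal.tsum_le_tsum fun j : ℕ => tsum_negPart_le h.hν' (μ - (2 * (j : ℝ) + 1) * ν)).trans ?_
  rw [tsum_eq_sum (s := Finset.range M) fun j hj => by rw [hvanish ν hBν j hj]; simp,
    tsum_eq_sum (s := Finset.range M) fun j hj => by rw [hvanish B le_rfl j hj]; simp,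
    ← ENNReal.ofReal_sum_of_nonneg fun j _ => div_nonneg (sq_nonneg _)
      (mul_nonneg zero_le_four h.hν'.le),
    ← ENNReal.ofReal_sum_of_nonneg fun j _ => mul_nonneg (div_nonneg hB.le hw.le) (sq_nonneg _)]
  refine ENNReal.ofReal_le_ofReal ?_
  have h1 := mul_sum_posPart_sq_le hB hBν (μ := μ) (M := M) (by nlinarith)
  simp_rw [h.inv_eq]
  rw [← Finset.sum_div, ← Finset.mul_sum, ← Finset.mul_sum, div_mul_eq_mul_div]
  exact div_le_div_of_nonneg_right h1 hw.le

/-- Only the `j = 0` row is kept and bounded below by an integral; then `ν` is replaced by `B`. -/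
lemma le_negTrace (h : IsFreqPair B ω₁ ω₂ ν ν') (hBν : B ≤ ν) (μ : ℝ) :
    ENNReal.ofReal (B * (μ - (ν + ν'))⁺ ^ 2 / (4 * (ω₁ * ω₂))) ≤
      negTrace (magSchrodinger B (oscPotential ω₁ ω₂ μ)) := by
  have hw : 0 < 4 * (ω₁ * ω₂) := by
    have := h.hω₁
    have := h.hω₂
    positivity
  rw [h.negTrace_eq]
  refine le_trans ?_ (ENNReal.le_tsum 0)
  refine le_trans ?_ (le_tsum_negPart h.hν' _)
  refine ENNReal.ofReal_le_ofReal ?_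
  rw [h.inv_eq]
  have h1 : μ - (2 * ((0 : ℕ) : ℝ) + 1) * ν - ν' = μ - (ν + ν') := by push_cast; ring
  rw [h1]
  gcongr

end IsFreqPair

/-- The larger normal frequency. -/
def freqPlus (B ω₁ ω₂ : ℝ) : ℝ := (√((ω₁ + ω₂) ^ 2 + B ^ 2) + √((ω₁ - ω₂) ^ 2 + B ^ 2)) / 2

/-- The smaller normal frequency. -/
def freqMinus (B ω₁ ω₂ : ℝ) : ℝ := (√((ω₁ + ω₂) ^ 2 + B ^ 2) - √((ω₁ - ω₂) ^ 2 + B ^ 2)) / 2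

/-- The two roots are `ν + ν'` and `ν - ν'`; the second is positive because `B > 0`, even when `ω₁ =
ω₂`. -/
lemma isFreqPair_freq (hB : 0 < B) (h₁ : 0 < ω₁) (h₂ : 0 < ω₂) :
    IsFreqPair B ω₁ ω₂ (freqPlus B ω₁ ω₂) (freqMinus B ω₁ ω₂) := by
  have hS : √((ω₁ + ω₂) ^ 2 + B ^ 2) ^ 2 = (ω₁ + ω₂) ^ 2 + B ^ 2 := Real.sq_sqrt (by positivity)
  have hD : √((ω₁ - ω₂) ^ 2 + B ^ 2) ^ 2 = (ω₁ - ω₂) ^ 2 + B ^ 2 := Real.sq_sqrt (by positivity)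
  have hD0 : 0 < √((ω₁ - ω₂) ^ 2 + B ^ 2) := Real.sqrt_pos.2 (by positivity)
  have hlt : √((ω₁ - ω₂) ^ 2 + B ^ 2) < √((ω₁ + ω₂) ^ 2 + B ^ 2) :=
    Real.sqrt_lt_sqrt (by positivity) (by nlinarith [mul_pos h₁ h₂])
  refine ⟨hB, h₁, h₂, ?_, ?_, ?_, ?_, ?_⟩ <;> simp only [freqPlus, freqMinus]
  · linarith
  · linarith
  · linear_combination (hS - hD) / 4
  · linear_combination (hS + hD) / 2
  · intro h
    linarith

lemma le_freqPlus (B ω₁ ω₂ : ℝ) : B ≤ freqPlus B ω₁ ω₂ := by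
  have h1 : B ≤ √((ω₁ + ω₂) ^ 2 + B ^ 2) := Real.le_sqrt_of_sq_le
    (by nlinarith [sq_nonneg (ω₁ + ω₂)])
  have h2 : B ≤ √((ω₁ - ω₂) ^ 2 + B ^ 2) := Real.le_sqrt_of_sq_le
    (by nlinarith [sq_nonneg (ω₁ - ω₂)])
  rw [freqPlus]
  linarith

/-- The value `μ = 2B` lies between the Landau levels `B` and `3B`, so only `m = 0` contributes. -/
lemma magSemiclassical_isotropic (hB : 0 < B) {w : ℝ} (hw : 0 < w) :
    magSemiclassical B (oscPotential w w (2 * B)) =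
      ENNReal.ofReal (B * B ^ 2 / (4 * (w * w))) := by
  rw [magSemiclassical_oscPotential hB hw hw, tsum_eq_single 0]
  · have h1 : 2 * B - (2 * ((0 : ℕ) : ℝ) + 1) * B = B := by push_cast; ring
    rw [h1, posPart_of_nonneg hB.le]
    congr 1
    ring
  · intro m hm
    have hm' : (1 : ℝ) ≤ m := by exact_mod_cast Nat.one_le_iff_ne_zero.2 hm
    rw [posPart_eq_zero.2 (by nlinarith)]
    simp

/-- The ratio of the lower trace bound to the semiclassical value is `(2B - √(4w² + B²))₊² / B²`,
which tends to `1` as `w → 0`. -/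
lemma one_le_of_forall_negTrace_le (hB : 0 < B) {ρ : ℝ≥0∞}
    (h : ∀ w : ℝ, 0 < w → negTrace (magSchrodinger B (oscPotential w w (2 * B))) ≤
      ρ * magSemiclassical B (oscPotential w w (2 * B))) : 1 ≤ ρ := by
  have hle : ∀ w : ℝ, 0 < w →
      ENNReal.ofReal ((2 * B - √((w + w) ^ 2 + B ^ 2))⁺ ^ 2 / B ^ 2) ≤ ρ := by
    intro w hw
    have h1 := ((isFreqPair_freq hB hw hw).le_negTrace (le_freqPlus _ _ _) (2 * B)).trans (h w hw)
    rw [magSemiclassical_isotropic hB hw] at h1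
    have h2 := ENNReal.div_le_of_le_mul h1
    rw [← ENNReal.ofReal_div_of_pos (by positivity)] at h2
    refine le_trans (le_of_eq ?_) h2
    have h3 : freqPlus B w w + freqMinus B w w = √((w + w) ^ 2 + B ^ 2) := by
      rw [freqPlus, freqMinus]; ring
    rw [h3]
    congr 1
    field_simp
  have hcont : Continuous fun w : ℝ =>
      ENNReal.ofReal ((2 * B - √((w + w) ^ 2 + B ^ 2))⁺ ^ 2 / B ^ 2) := by
    simp only [posPart_def]
    exact ENNReal.continuous_ofReal.comp (by fun_prop)
  have hlim := (hcont.tendsto 0).mono_left (nhdsWithin_le_nhds (s := Set.Ioi 0))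
  have h0 : ENNReal.ofReal ((2 * B - √(((0 : ℝ) + 0) ^ 2 + B ^ 2))⁺ ^ 2 / B ^ 2) = 1 := by
    have h4 : √(((0 : ℝ) + 0) ^ 2 + B ^ 2) = B := by
      rw [add_zero, zero_pow two_ne_zero, zero_add, Real.sqrt_sq hB.le]
    have h5 : 2 * B - B = B := by ring
    rw [h4, h5, posPart_of_nonneg hB.le, div_self (by positivity), ENNReal.ofReal_one]
  rw [h0] at hlim
  exact le_of_tendsto hlim (eventually_nhdsWithin_of_forall fun w hw => hle w hw)

end Trace

end

theorem theorem1p2 (B : ℝ) (hB : 0 < B) :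
    (∀ ω₁ ω₂ μ : ℝ, 0 < ω₁ → 0 < ω₂ → 0 < μ →
      IsSelfAdjoint (magSchrodinger B (oscPotential ω₁ ω₂ μ)) ∧
      (∃! N : L2Plane →L[ℂ] L2Plane,
        IsNegPart (magSchrodinger B (oscPotential ω₁ ω₂ μ)) N) ∧
      negTrace (magSchrodinger B (oscPotential ω₁ ω₂ μ)) ≤
        magSemiclassical B (oscPotential ω₁ ω₂ μ)) ∧
    (∀ ρ : ℝ≥0∞,
      (∀ ω₁ ω₂ μ : ℝ, 0 < ω₁ → 0 < ω₂ → 0 < μ →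
        negTrace (magSchrodinger B (oscPotential ω₁ ω₂ μ)) ≤
          ρ * magSemiclassical B (oscPotential ω₁ ω₂ μ)) →
      1 ≤ ρ) := by
  refine ⟨fun ω₁ ω₂ μ h₁ h₂ _ => ?_, fun ρ hρ => ?_⟩
  · have hf := isFreqPair_freq hB h₁ h₂
    have hdiag := hf.isDiagonal_magSchrodinger μ
    obtain ⟨s, hs⟩ := hf.exists_finset μ
    exact ⟨hdiag.isSelfAdjoint, hdiag.existsUnique_isNegPart hs,
      hf.negTrace_le (le_freqPlus _ _ _) μ⟩
  · exact one_le_of_forall_negTrace_le hB fun w hw => hρ w w (2 * B) hw hw (by positivity)
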